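/- Let $F\colon\mathbb{R}^d\to\mathbb{R}^d$ be $L$-Lipschitz, let $G\colon\mathbb{R}^d\rightrightarrows\mathbb{R}^d$ be maximally monotone, let $\rho>0$, and let $F+G$ be maximally $\rho$-cohypomonotone, i.e. maximal (for inclusion of graphs) among the operators $A$ with $\langle u-v,x-y\rangle\ge-\rho\|u-v\|^2$ for all $u\in A(x)$, $v\in A(y)$. Let $x^\star$ satisfy $0\in F(x^\star)+G(x^\star)$. Let $F$ be accessed through a stochastic first-order oracle $\widetilde F$ with $\mathbb{E}[\widetilde F(x)]=F(x)$ and $\mathbb{E}\|\widetilde F(x)-F(x)\|^2\le\sigma^2$ for every $x$, every call using a fresh independent sample. Let $\rho<\eta<1/L$, $\alpha=1-\rho/\eta$, $\beta_k=\frac1{k+2}$, and write $J_A=(\mathrm{Id}+A)^{-1}$. Stochastic Halpern iteration: given $x_0\in\mathbb{R}^d$, for $k=0,1,2,\dots$ $$x_{k+1}=\beta_kx_0+(1-\beta_k)\big((1-\alpha)x_k+\alpha\widetilde J_k\big),$$ where $\widetilde J_k=z_{N_k}$ is the output of $N_k=\left\lceil\frac{1734(k+2)^3\log^2(k+2)}{(1-\eta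 L)^2}\right\rceil$ steps of stochastic forward-backward-forward (FBF) started at $z_0=x_k$: with $\widetilde B(z)=z+\eta\widetilde F(z)-x_k$ and $\tau_t=\frac{2}{(t+1)(1-\eta L)+6(1+\eta L)}$, $$z_{t+1/2}=J_{\tau_t\eta G}\big(z_t-\tau_t\widetilde B(z_t)\big),\qquad z_{t+1}=z_{t+1/2}+\tau_t\widetilde B(z_t)-\tau_t\widetilde B(z_{t+1/2}),$$ the same sample of $\widetilde B(z_t)$ being used in both formulas. Then $J:=J_{\eta(F+G)}$ and the resolvents of the positive multiples of $G$ are everywhere defined and single-valued, and: 1. For every $k\ge1$, $$\frac1{\eta^2}\,\mathbb{E}\|x_k-J(x_k)\|^2\le\frac{36\left(\|x_0-x^\star\|^2+\eta^2\sigma^2\right)}{(\eta-\rho)^2k^2}.$$ 2. Outer iteration $k$ uses at most $2\left\lceil\frac{1734(k+2)^3\log^2(k+2)}{(1-\eta L)^2}\right\rceil$ evaluations of $\widetilde F$, and at most half as many resolvents of positive multiples of $G$. 3. For every $\varepsilon>0$ there is $K\ge1$ such that the last iterate satisfies $\mathbb{E}\big[\eta^{-1}\|x_K-J(x_K)\|\big]\le\varepsilon$,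 and the total number of stochastic first-order oracle calls (evaluations of $\widetilde F$, and also resolvents of $G$) made up to $x_K$ is at most $$C\,\frac{1+Q}{(1-\eta L)^2}\,\log^2(2+Q),\qquad Q=\frac{\|x_0-x^\star\|^4+\eta^4\sigma^4}{(\eta-\rho)^4\varepsilon^4},$$ with a universal constant $C>0$; that is, $\widetilde O(\varepsilon^{-4})$ calls. -/

import Mathlib

open MeasureTheory ProbabilityTheory
open scoped NNReal ENNReal

/-- A set-valued operator `A : E ⇉ E` is given by its values `A x ⊆ E`; its graph is
`{(x, u) | u ∈ A x}`.  It is `ρ`-cohypomonotone if `⟨u - v, x - y⟩ ≥ -ρ ‖u - v‖²` on the graph. -/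
def IsCohypomonotone {E : Type*} [NormedAddCommGroup E] [InnerProductSpace ℝ E]
    (ρ : ℝ) (A : E → Set E) : Prop :=
  ∀ x y : E, ∀ u ∈ A x, ∀ v ∈ A y, -ρ * ‖u - v‖ ^ 2 ≤ inner ℝ (u - v) (x - y)

/-- Monotonicity of a set-valued operator. -/
def IsMonotoneOperator {E : Type*} [NormedAddCommGroup E] [InnerProductSpace ℝ E]
    (A : E → Set E) : Prop :=
  ∀ x y : E, ∀ u ∈ A x, ∀ v ∈ A y, 0 ≤ inner ℝ (u - v) (x - y)

/-- Maximality with respect to inclusion of graphs: the operator has the property `P`, and its graph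
is not strictly contained in the graph of an operator with the property `P`. -/
def IsMaximalOperator {E : Type*} (P : (E → Set E) → Prop) (A : E → Set E) : Prop :=
  P A ∧ ∀ A' : E → Set E, P A' → (∀ x, A x ⊆ A' x) → ∀ x, A' x ⊆ A x

/-- Maximally monotone operators. -/
def IsMaximallyMonotone {E : Type*} [NormedAddCommGroup E] [InnerProductSpace ℝ E]
    (A : E → Set E) : Prop :=
  IsMaximalOperator IsMonotoneOperator A

/-- Maximally `ρ`-cohypomonotone operators. -/
def IsMaximallyCohypomonotone {E : Type*} [NormedAddCommGroup E] [InnerProductSpace ℝ E]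
    (ρ : ℝ) (A : E → Set E) : Prop :=
  IsMaximalOperator (IsCohypomonotone ρ) A

/-- The operator `c A`. -/
def scaleOperator {E : Type*} [AddCommGroup E] [Module ℝ E]
    (c : ℝ) (A : E → Set E) : E → Set E :=
  fun x => {u | ∃ a ∈ A x, u = c • a}

/-- The operator `F + G` for a single-valued `F` and a set-valued `G`. -/
def sumOperator {E : Type*} [AddCommGroup E] (F : E → E) (G : E → Set E) : E → Set E :=
  fun x => {u | ∃ g ∈ G x, u = F x + g}

/-- `y` is a value of the resolvent `J_A = (Id + A)⁻¹` at `x`, that is, `x ∈ y + A y`. -/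
def IsResolventValue {E : Type*} [AddCommGroup E] (A : E → Set E) (x y : E) : Prop :=
  x - y ∈ A y

/-- The resolvent `J_A` as a function: `resolvent A x` is a solution `y` of `x ∈ y + A y`.
It is a meaningful value wherever there is exactly one such `y`. -/
noncomputable def operatorResolvent {E : Type*} [AddCommGroup E] (A : E → Set E) (x : E) : E :=
  Classical.epsilon fun y => IsResolventValue A x y

/-- A stochastic first-order oracle `Ft x s` (query point `x`, random seed `s ∼ P`) for `F`:
`E[Ft x] = F x` and `E ‖Ft x - F x‖² ≤ σ²` at every point `x`. -/
structure IsStochasticOracle {E S : Type*} [NormedAddCommGroup E] [NormedSpace ℝ E]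
    [MeasurableSpace E] [MeasurableSpace S] (P : Measure S) (F : E → E) (Ft : E → S → E)
    (σ : ℝ) : Prop where
  measurable : Measurable (Function.uncurry Ft)
  integrable : ∀ x, Integrable (Ft x) P
  unbiased : ∀ x, ∫ s, Ft x s ∂P = F x
  variance_le : ∀ x, ∫⁻ s, ‖Ft x s - F x‖ₑ ^ 2 ∂P ≤ ENNReal.ofReal (σ ^ 2)

/-- State of an algorithm with oracle access: the current point, the number of evaluations of the
stochastic oracle made so far, and the number of resolvent evaluations made so far. -/
structure OracleState (E : Type*) where
  point : E
  evals : ℕ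
  resolvents : ℕ

/-- One step of stochastic forward-backward-forward for `0 ∈ (A + B) z` with step size `τ`.  The
`n`-th evaluation of the stochastic oracle uses the `n`-th entry of the stream of seeds, so every
evaluation uses a fresh seed, and the value `Bt (z_t)` is drawn once and used twice. -/
noncomputable def fbfStep {E S : Type*} [AddCommGroup E] [Module ℝ E]
    (A : E → Set E) (Bt : E → S → E) (τ : ℝ) (seeds : ℕ → S) (z : OracleState E) :
    OracleState E :=
  let b : E := Bt z.point (seeds z.evals)
  let zHalf : E := operatorResolvent (scaleOperator τ A) (z.point - τ • b)
  let bHalf : E := Bt zHalf (seeds (z.evals + 1))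
  { point := zHalf + τ • b - τ • bHalf
    evals := z.evals + 2
    resolvents := z.resolvents + 1 }

/-- Stochastic forward-backward-forward from `z₀` after a number of steps, with
`Bt = BtIn - z₀` and step sizes `τ_t = 2 / ((t + 1) μ + 6 L_B)`. -/
noncomputable def stochasticFBF {E S : Type*} [AddCommGroup E] [Module ℝ E]
    (A : E → Set E) (BtIn : E → S → E) (LB μ : ℝ) (seeds : ℕ → S) (z₀ : OracleState E) :
    ℕ → OracleState E
  | 0 => z₀
  | t + 1 =>
      fbfStep A (fun z s => BtIn z s - z₀.point) (2 / (((t : ℝ) + 1) * μ + 6 * LB)) seeds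
        (stochasticFBF A BtIn LB μ seeds z₀ t)

/-- The number of inner steps `N_k = ⌈1734 (k + 2)³ log² (k + 2) / (1 - η L)²⌉`. -/
noncomputable def innerIterations (η L : ℝ) (k : ℕ) : ℕ :=
  ⌈1734 * ((k : ℝ) + 2) ^ 3 * Real.log ((k : ℝ) + 2) ^ 2 / (1 - η * L) ^ 2⌉₊

/-- Stochastic inexact Halpern iteration for `0 ∈ F x + G x` from `x₀`, with `β_k = 1 / (k + 2)`,
`α = 1 - ρ / η`: the state after `k` outer iterations, along a given stream of seeds. The resolvent
of `η (F + G)` at `x_k` is approximated by stochastic forward-backward-forward with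
`A = η G`, `BtIn = Id + η Ft`, `L_B = 1 + η L` and `μ = 1 - η L`. -/
noncomputable def stochasticHalpern {E S : Type*} [AddCommGroup E] [Module ℝ E]
    (G : E → Set E) (Ft : E → S → E) (η L ρ : ℝ) (x₀ : E) (seeds : ℕ → S) :
    ℕ → OracleState E
  | 0 => { point := x₀, evals := 0, resolvents := 0 }
  | k + 1 =>
      let x : OracleState E := stochasticHalpern G Ft η L ρ x₀ seeds k
      let J : OracleState E :=
        stochasticFBF (scaleOperator η G) (fun z s => z + η • Ft z s) (1 + η * L) (1 - η * L)
          seeds x (innerIterations η L k)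
      let β : ℝ := 1 / ((k : ℝ) + 2)
      let α : ℝ := 1 - ρ / η
      { point := β • x₀ + (1 - β) • ((1 - α) • x.point + α • J.point)
        evals := J.evals
        resolvents := J.resolvents }

/-!
Cohypomonotonicity of `F + G` makes `α (Id - J)` firmly nonexpansive for `J = J_{η(F+G)}` and
`α = 1 - ρ / η`, so the outer loop is an inexact Halpern iteration for a nonexpansive map. Such an
iteration decreases the potential
`(n - 1) n / 2 ‖R x‖² + n ⟨R x, x - x₀⟩` of the residual `R = α (Id - J)` up to the evaluation
errors. The relative part of these errors is absorbed by the potential and the rest is summable,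
because the inner loop is accurate to order `1 / N_k` in mean square and
`∑ 1 / ((k + 2) log² (k + 2))` converges.

The point `J x_k` is the zero of the sum of the maximally monotone operator `η G` and the strongly
monotone Lipschitz map `z ↦ z + η F z - x_k`. On such a sum a forward-backward-forward step
contracts the mean squared distance to the zero up to a noise term of order `τ²`, since its
half step depends only on the seeds before the fresh one and the noise is orthogonal to it.
-/

section Operators

variable {E : Type*} [AddCommGroup E]

theorem isResolventValue_operatorResolvent {A : E → Set E} {x : E}
    (h : ∃ y, IsResolventValue A x y) : IsResolventValue A x (operatorResolvent A x) :=
  Classical.epsilon_spec h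

variable [Module ℝ E]

theorem scaleOperator_one (A : E → Set E) : scaleOperator 1 A = A := by
  funext x
  simp [scaleOperator]

theorem scaleOperator_scaleOperator (a b : ℝ) (A : E → Set E) :
    scaleOperator a (scaleOperator b A) = scaleOperator (a * b) A := by
  funext x
  ext u
  simp [scaleOperator, mul_smul]

theorem scaleOperator_mono (c : ℝ) {A B : E → Set E} (h : ∀ x, A x ⊆ B x) (x : E) :
    scaleOperator c A x ⊆ scaleOperator c B x :=
  fun _ ⟨a, ha, hu⟩ => ⟨a, h x ha, hu⟩

theorem isResolventValue_scaleOperator_sumOperator_iff {F : E → E} {G : E → Set E} {η : ℝ}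
    {x y : E} :
    IsResolventValue (scaleOperator η (sumOperator F G)) x y ↔
      IsResolventValue (scaleOperator η G) (x - η • F y) y := by
  constructor
  · rintro ⟨_, ⟨g, hg, rfl⟩, h⟩
    exact ⟨g, hg, by rw [sub_right_comm, h, smul_add, add_sub_cancel_left]⟩
  · rintro ⟨g, hg, h⟩
    exact ⟨_, ⟨g, hg, rfl⟩, by rw [smul_add, ← h]; abel⟩

end Operators

section Monotone

variable {E : Type*} [NormedAddCommGroup E] [InnerProductSpace ℝ E] {A G : E → Set E} {c : ℝ}

/-- A map is firmly nonexpansive if `‖R x - R y‖² ≤ ⟨R x - R y, x - y⟩`, that is, cocoercive with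
constant `1`. -/
def IsFirmlyNonexpansive (R : E → E) : Prop :=
  ∀ x y, ‖R x - R y‖ ^ 2 ≤ inner ℝ (R x - R y) (x - y)

theorem IsFirmlyNonexpansive.lipschitzWith {R : E → E} (hR : IsFirmlyNonexpansive R) :
    LipschitzWith 1 R := by
  refine LipschitzWith.of_dist_le_mul fun x y => ?_
  rw [NNReal.coe_one, one_mul, dist_eq_norm, dist_eq_norm]
  have hxy := (hR x y).trans (real_inner_le_norm _ _)
  by_contra! hlt
  nlinarith [norm_nonneg (x - y)]

theorem IsMonotoneOperator.scale (hA : IsMonotoneOperator A) (hc : 0 ≤ c) :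
    IsMonotoneOperator (scaleOperator c A) := by
  rintro x y _ ⟨u, hu, rfl⟩ _ ⟨v, hv, rfl⟩
  rw [← smul_sub, real_inner_smul_left]
  exact mul_nonneg hc (hA x y u hu v hv)

theorem IsMonotoneOperator.norm_sub_sq_le_inner_of_isResolventValue (hA : IsMonotoneOperator A)
    {x x' y y' : E} (h : IsResolventValue A x y) (h' : IsResolventValue A x' y') :
    ‖y - y'‖ ^ 2 ≤ inner ℝ (y - y') (x - x') := by
  have hyy' := hA y y' _ h _ h'
  rw [sub_sub_sub_comm, inner_sub_left, real_inner_self_eq_norm_sq, real_inner_comm] at hyy'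
  linarith

theorem IsMonotoneOperator.isFirmlyNonexpansive (hA : IsMonotoneOperator A) {J : E → E}
    (hJ : ∀ x, IsResolventValue A x (J x)) : IsFirmlyNonexpansive J :=
  fun x y => hA.norm_sub_sq_le_inner_of_isResolventValue (hJ x) (hJ y)

theorem IsMonotoneOperator.isResolventValue_unique (hA : IsMonotoneOperator A) {x y y' : E}
    (h : IsResolventValue A x y) (h' : IsResolventValue A x y') : y = y' := by
  have hyy' := hA.norm_sub_sq_le_inner_of_isResolventValue h h'
  rw [sub_self, inner_zero_right] at hyy'
  exact sub_eq_zero.1 (norm_eq_zero.1 (pow_eq_zero_iff two_ne_zero |>.1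
    (le_antisymm hyy' (sq_nonneg _))))

theorem IsMaximallyMonotone.scale (hG : IsMaximallyMonotone G) (hc : 0 < c) :
    IsMaximallyMonotone (scaleOperator c G) := by
  refine ⟨hG.1.scale hc.le, fun A hA hGA x u hu => ?_⟩
  have hG_sub : ∀ y, G y ⊆ scaleOperator c⁻¹ A y := fun y => by
    have hsub := scaleOperator_mono c⁻¹ hGA y
    rwa [scaleOperator_scaleOperator, inv_mul_cancel₀ hc.ne', scaleOperator_one] at hsub
  have hA_sub := scaleOperator_mono c (hG.2 _ (hA.scale (inv_nonneg.2 hc.le)) hG_sub) x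
  rw [scaleOperator_scaleOperator, mul_inv_cancel₀ hc.ne', scaleOperator_one] at hA_sub
  exact hA_sub hu

theorem IsMaximallyMonotone.mem_of_forall_inner_nonneg (hA : IsMaximallyMonotone A) {x u : E}
    (h : ∀ y, ∀ v ∈ A y, 0 ≤ inner ℝ (u - v) (x - y)) : u ∈ A x := by
  refine hA.2 (fun y => A y ∪ {v | y = x ∧ v = u}) ?_ (fun _ => Set.subset_union_left) x
    (Or.inr ⟨rfl, rfl⟩)
  rintro a b v (hv | ⟨rfl, rfl⟩) w (hw | ⟨rfl, rfl⟩)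
  · exact hA.1 a b v hv w hw
  · rw [← neg_sub, ← neg_sub b a, inner_neg_neg]
    exact h a v hv
  · exact h b w hw
  · simp

end Monotone

section Minty

variable {E : Type*} [NormedAddCommGroup E] [InnerProductSpace ℝ E]

theorem inner_sub_sub_eq_norm_sub_midpoint_sq (u z y : E) :
    inner ℝ (y - u) (y - z) = ‖y - midpoint ℝ u z‖ ^ 2 - (‖u - z‖ / 2) ^ 2 := by
  have hm : y - midpoint ℝ u z = (1 / 2 : ℝ) • ((y - u) + (y - z)) := by
    rw [midpoint_eq_smul_add, invOf_eq_inv]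
    module
  have hd : u - z = (y - z) - (y - u) := by abel
  rw [hm, hd, norm_smul, mul_pow, div_pow, norm_add_sq_real (y - u), norm_sub_sq_real (y - z),
    real_inner_comm (y - u) (y - z)]
  norm_num
  ring

theorem inner_sub_sub_nonpos_iff_mem_closedBall {u z y : E} :
    inner ℝ (y - u) (y - z) ≤ 0 ↔ y ∈ Metric.closedBall (midpoint ℝ u z) (‖u - z‖ / 2) := by
  rw [inner_sub_sub_eq_norm_sub_midpoint_sq, sub_nonpos, mem_closedBall_iff_norm,
    sq_le_sq₀ (norm_nonneg _) (by positivity)]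

/-- Chebyshev's sum inequality for an antitone pairing. -/
theorem sum_mul_inner_sub_sub_nonpos {ι : Type*} [Fintype ι] {u z : ι → E}
    (h : ∀ i j, inner ℝ (u i - u j) (z i - z j) ≤ 0) {w : ι → ℝ} (hw : w ∈ stdSimplex ℝ ι)
    {y : E} (hy : y = ∑ i, w i • midpoint ℝ (u i) (z i)) :
    ∑ i, w i * inner ℝ (y - u i) (y - z i) ≤ 0 := by
  set U := ∑ i, w i • u i
  set Z := ∑ i, w i • z i
  have hyUZ : y = (1 / 2 : ℝ) • (U + Z) := by
    simp only [hy, U, Z, ← Finset.sum_add_distrib, Finset.smul_sum, midpoint_eq_smul_add,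
      invOf_eq_inv]
    exact Finset.sum_congr rfl fun i _ => by module
  have hcheb : ∑ i, w i * inner ℝ (u i) (z i) ≤ inner ℝ U Z := by
    have hpair : ∑ i, ∑ j, w i * w j * inner ℝ (u i - u j) (z i - z j) ≤ 0 :=
      Finset.sum_nonpos fun i _ => Finset.sum_nonpos fun j _ =>
        mul_nonpos_of_nonneg_of_nonpos (mul_nonneg (hw.1 i) (hw.1 j)) (h i j)
    have hexpand : ∀ i j, w i * w j * inner ℝ (u i - u j) (z i - z j) =
        w j * (w i * inner ℝ (u i) (z i)) - inner ℝ (w i • u i) (w j • z j)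
          - inner ℝ (w j • u j) (w i • z i) + w i * (w j * inner ℝ (u j) (z j)) := by
      intro i j
      simp only [inner_sub_left, inner_sub_right, real_inner_smul_left, real_inner_smul_right]
      ring
    simp only [hexpand, Finset.sum_add_distrib, Finset.sum_sub_distrib, ← Finset.sum_mul,
      ← Finset.mul_sum, ← inner_sum, ← sum_inner, hw.2, one_mul] at hpair
    linarith
  calc ∑ i, w i * inner ℝ (y - u i) (y - z i)
      = ‖y‖ ^ 2 - inner ℝ y (U + Z) + ∑ i, w i * inner ℝ (u i) (z i) := by
        simp only [U, Z, inner_sub_left, inner_sub_right, mul_sub, Finset.sum_sub_distrib,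
          inner_add_right, inner_sum, real_inner_smul_right, real_inner_self_eq_norm_sq,
          ← Finset.sum_mul, hw.2, real_inner_comm y]
        ring
    _ ≤ ‖y‖ ^ 2 - inner ℝ y (U + Z) + inner ℝ U Z := by gcongr
    _ = -‖U - Z‖ ^ 2 / 4 := by
        rw [hyUZ, norm_smul, real_inner_smul_left, real_inner_self_eq_norm_sq, mul_pow,
          norm_add_sq_real, norm_sub_sq_real]
        norm_num
        ring
    _ ≤ 0 := by nlinarith [sq_nonneg ‖U - Z‖]

theorem convexOn_inner_sub_sub (u z : E) :
    ConvexOn ℝ Set.univ fun y => inner ℝ (y - u) (y - z) := by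
  have hdist := (convexOn_univ_dist (midpoint ℝ u z)).pow (fun _ _ => dist_nonneg) 2
  refine (hdist.add_const (-(‖u - z‖ / 2) ^ 2)).congr fun y _ => ?_
  rw [inner_sub_sub_eq_norm_sub_midpoint_sq, ← dist_eq_norm y, Pi.add_apply, Pi.pow_apply]
  ring

/-- Play the game with payoff `∑ i, w i * ⟨y - u i, y - z i⟩` over weights `w` against points `y` in
the convex hull of the midpoints: at a saddle point, the Chebyshev inequality bounds the value. -/
theorem exists_forall_inner_sub_sub_nonpos {ι : Type*} [Finite ι] {u z : ι → E}
    (h : ∀ i j, inner ℝ (u i - u j) (z i - z j) ≤ 0) :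
    ∃ y : E, ∀ i, inner ℝ (y - u i) (y - z i) ≤ 0 := by
  classical
  cases nonempty_fintype ι
  rcases isEmpty_or_nonempty ι with _ | hι
  · exact ⟨0, isEmptyElim⟩
  let m : ι → E := fun i => midpoint ℝ (u i) (z i)
  let payoff : E → (ι → ℝ) → ℝ := fun y w => ∑ i, w i * inner ℝ (y - u i) (y - z i)
  have hcont : Continuous fun p : E × (ι → ℝ) => payoff p.1 p.2 := by fun_prop
  have hconvex : ∀ w ∈ stdSimplex ℝ ι, ConvexOn ℝ Set.univ fun y => payoff y w := fun w hw => by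
    have hsum := Finset.sum_induction (s := Finset.univ)
      (fun i y => w i * inner ℝ (y - u i) (y - z i)) (ConvexOn ℝ Set.univ)
      (fun _ _ => ConvexOn.add) (convexOn_const 0 convex_univ)
      fun i _ => (convexOn_inner_sub_sub (u i) (z i)).smul (hw.1 i)
    rwa [Finset.sum_fn] at hsum
  have hconcave : ∀ y, ConcaveOn ℝ (stdSimplex ℝ ι) (payoff y) := fun y =>
    (Fintype.linearCombination ℝ fun i => (inner ℝ (y - u i) (y - z i) : ℝ)).concaveOn
      (convex_stdSimplex ℝ ι)
  obtain ⟨y, -, w, hw, hsaddle⟩ := Sion.exists_isSaddlePointOn (f := payoff)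
    ((Set.range_nonempty m).mono (subset_convexHull ℝ _)) (convex_convexHull ℝ (Set.range m))
    ((Set.finite_range m).isCompact_convexHull ℝ)
    (fun w _ => (hcont.comp (.prodMk_left w)).lowerSemicontinuous.lowerSemicontinuousOn _)
    (fun w hw => ((hconvex w hw).subset (Set.subset_univ _) (convex_convexHull ℝ _)).quasiconvexOn)
    (convex_stdSimplex ℝ ι) ⟨_, single_mem_stdSimplex ℝ hι.some⟩ (isCompact_stdSimplex ℝ ι)
    (fun y _ => (hcont.comp (.prodMk_right y)).upperSemicontinuous.upperSemicontinuousOn _)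
    (fun y _ => (hconcave y).quasiconcaveOn)
  refine ⟨y, fun i => ?_⟩
  calc inner ℝ (y - u i) (y - z i)
      = payoff y (Pi.single i 1) := by simp [payoff, Pi.single_apply]
    _ ≤ payoff (∑ j, w j • m j) w :=
        hsaddle _ ((convex_convexHull ℝ _).sum_mem (fun j _ => hw.1 j) hw.2
          fun j _ => subset_convexHull ℝ _ ⟨j, rfl⟩) _ (single_mem_stdSimplex ℝ i)
    _ ≤ 0 := sum_mul_inner_sub_sub_nonpos h hw rfl

theorem exists_forall_mem_closedBall_of_finset [CompleteSpace E] {ι : Type*} (c : ι → E)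
    (r : ι → ℝ)
    (h : ∀ t : Finset ι, ∃ y, ∀ i ∈ t, y ∈ Metric.closedBall (c i) (r i)) :
    ∃ y, ∀ i, y ∈ Metric.closedBall (c i) (r i) := by
  classical
  rcases isEmpty_or_nonempty ι with _ | ⟨⟨i₀⟩⟩
  · exact ⟨0, isEmptyElim⟩
  let Φ := InnerProductSpace.toDual ℝ E
  let ball : ι → Set (WeakDual ℝ E) := fun i =>
    WeakDual.toStrongDual ⁻¹' Metric.closedBall (Φ (c i)) (r i)
  obtain ⟨f, -, hf⟩ := (WeakDual.isCompact_closedBall (Φ (c i₀)) (r i₀)).inter_iInter_nonempty ball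
    (fun i => WeakDual.isClosed_closedBall _ _) fun t => by
      obtain ⟨y, hy⟩ := h (insert i₀ t)
      have hball : ∀ i ∈ insert i₀ t, StrongDual.toWeakDual (Φ y) ∈ ball i := fun i hi => by
        simpa [ball] using hy i hi
      exact ⟨_, hball i₀ (Finset.mem_insert_self _ _),
        Set.mem_iInter₂.2 fun i hi => hball i (Finset.mem_insert_of_mem hi)⟩
  refine ⟨Φ.symm (WeakDual.toStrongDual f), fun i => ?_⟩
  have hfi : dist (WeakDual.toStrongDual f) (Φ (c i)) ≤ r i := Set.mem_iInter.1 hf i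
  rwa [Metric.mem_closedBall, ← Φ.dist_map, Φ.apply_symm_apply]

variable [CompleteSpace E] {G : E → Set E}

/-- Minty's theorem: `y` has to lie in a closed ball for each point of the graph, so by weak
compactness finitely many points suffice. -/
theorem IsMaximallyMonotone.exists_isResolventValue (hG : IsMaximallyMonotone G) (x : E) :
    ∃ y, IsResolventValue G x y := by
  obtain ⟨y, hy⟩ := exists_forall_mem_closedBall_of_finset
    (fun p : {p : E × E // p.2 ∈ G p.1} => midpoint ℝ (x - p.1.2) p.1.1)
    (fun p => ‖x - p.1.2 - p.1.1‖ / 2) fun t => by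
      obtain ⟨y, hy⟩ := exists_forall_inner_sub_sub_nonpos
        (u := fun p : t => x - p.1.1.2) (z := fun p : t => p.1.1.1) fun p q => by
          rw [sub_sub_sub_cancel_left, ← neg_sub, inner_neg_left, neg_nonpos]
          exact hG.1 _ _ _ p.1.2 _ q.1.2
      exact ⟨y, fun p hp => inner_sub_sub_nonpos_iff_mem_closedBall.1 (hy ⟨p, hp⟩)⟩
  refine ⟨y, hG.mem_of_forall_inner_nonneg fun z w hw => ?_⟩
  have hyz := inner_sub_sub_nonpos_iff_mem_closedBall.2 (hy ⟨(z, w), hw⟩)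
  rw [← neg_sub, inner_neg_left] at hyz
  rw [sub_right_comm]
  linarith

theorem IsMaximallyMonotone.existsUnique_isResolventValue (hG : IsMaximallyMonotone G) (x : E) :
    ∃! y, IsResolventValue G x y :=
  existsUnique_of_exists_of_unique (hG.exists_isResolventValue x)
    fun _ _ => hG.1.isResolventValue_unique

theorem IsMaximallyMonotone.isResolventValue_operatorResolvent (hG : IsMaximallyMonotone G)
    (x : E) : IsResolventValue G x (operatorResolvent G x) :=
  _root_.isResolventValue_operatorResolvent (hG.exists_isResolventValue x)

theorem IsMaximallyMonotone.lipschitzWith_operatorResolvent (hG : IsMaximallyMonotone G) :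
    LipschitzWith 1 (operatorResolvent G) :=
  (hG.1.isFirmlyNonexpansive hG.isResolventValue_operatorResolvent).lipschitzWith

/-- For `η L < 1` the fixed points of the contraction `y ↦ J_{ηG} (x - η F y)` are the values of
the resolvent. -/
theorem IsMaximallyMonotone.existsUnique_isResolventValue_sumOperator
    (hG : IsMaximallyMonotone G) {F : E → E} {L : ℝ≥0} (hF : LipschitzWith L F)
    {η : ℝ} (hη : 0 < η) (hηL : η * L < 1) (x : E) :
    ∃! y, IsResolventValue (scaleOperator η (sumOperator F G)) x y := by
  have hηG := hG.scale hη
  let f : E → E := fun y => operatorResolvent (scaleOperator η G) (x - η • F y)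
  have hfix : ∀ y, IsResolventValue (scaleOperator η (sumOperator F G)) x y ↔
      Function.IsFixedPt f y := fun y => by
    rw [isResolventValue_scaleOperator_sumOperator_iff]
    refine ⟨hηG.1.isResolventValue_unique (hηG.isResolventValue_operatorResolvent _), fun hy => ?_⟩
    nth_rw 2 [← hy.eq]
    exact hηG.isResolventValue_operatorResolvent _
  have hcontr : ContractingWith (1 * (0 + ‖η‖₊ * L)) f := by
    refine ⟨?_, hηG.lipschitzWith_operatorResolvent.comp
      ((LipschitzWith.const x).sub ((lipschitzWith_smul η).comp hF))⟩
    rw [one_mul, zero_add, ← NNReal.coe_lt_coe]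
    simpa [abs_of_pos hη] using hηL
  simp only [hfix]
  exact ⟨_, hcontr.fixedPoint_isFixedPt, fun _ => hcontr.fixedPoint_unique⟩

theorem IsMaximallyMonotone.isResolventValue_operatorResolvent_sumOperator
    (hG : IsMaximallyMonotone G) {F : E → E} {L : ℝ≥0} (hF : LipschitzWith L F)
    {η : ℝ} (hη : 0 < η) (hηL : η * L < 1) (x : E) :
    IsResolventValue (scaleOperator η (sumOperator F G)) x
      (operatorResolvent (scaleOperator η (sumOperator F G)) x) :=
  _root_.isResolventValue_operatorResolvent
    (hG.existsUnique_isResolventValue_sumOperator hF hη hηL x).exists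

end Minty

section Cohypomonotone

variable {E : Type*} [NormedAddCommGroup E] [InnerProductSpace ℝ E]

theorem IsCohypomonotone.isFirmlyNonexpansive_smul_sub {T : E → Set E} {ρ η : ℝ}
    (hT : IsCohypomonotone ρ T) (hη : 0 < η) (hρη : ρ ≤ η) {J : E → E}
    (hJ : ∀ x, IsResolventValue (scaleOperator η T) x (J x)) :
    IsFirmlyNonexpansive fun x => (1 - ρ / η) • (x - J x) := by
  intro x y
  have hα : 0 ≤ 1 - ρ / η := sub_nonneg.2 ((div_le_one hη).2 hρη)
  obtain ⟨u, hu, hxu⟩ := hJ x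
  obtain ⟨v, hv, hyv⟩ := hJ y
  have hxy : x - y = η • (u - v) + (J x - J y) := by
    rw [smul_sub, ← hxu, ← hyv]; abel
  have hcocoercive : (1 - ρ / η) * ‖η • (u - v)‖ ^ 2 ≤ inner ℝ (η • (u - v)) (x - y) := by
    calc (1 - ρ / η) * ‖η • (u - v)‖ ^ 2
        = ‖η • (u - v)‖ ^ 2 + η * (-ρ * ‖u - v‖ ^ 2) := by
          rw [norm_smul, mul_pow, Real.norm_of_nonneg hη.le]
          field_simp
          ring
      _ ≤ ‖η • (u - v)‖ ^ 2 + η * inner ℝ (u - v) (J x - J y) := by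
          gcongr
          exact hT _ _ u hu v hv
      _ = inner ℝ (η • (u - v)) (x - y) := by
          rw [hxy, inner_add_right, real_inner_self_eq_norm_sq, real_inner_smul_left _ (J x - J y)]
  simp only [hxu, hyv, ← smul_sub] at hcocoercive ⊢
  rw [norm_smul, mul_pow, Real.norm_of_nonneg hα, real_inner_smul_left, sq, mul_assoc]
  exact mul_le_mul_of_nonneg_left hcocoercive hα

/-- A single-valued map `B` is `μ`-strongly monotone if
`⟨B x - B y, x - y⟩ ≥ μ ‖x - y‖²`. -/
def IsStronglyMonotone (μ : ℝ) (B : E → E) : Prop :=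
  ∀ x y, μ * ‖x - y‖ ^ 2 ≤ inner ℝ (B x - B y) (x - y)

theorem isStronglyMonotone_id_add_smul {F : E → E} {L : ℝ≥0} (hF : LipschitzWith L F) {η : ℝ}
    (hη : 0 ≤ η) : IsStronglyMonotone (1 - η * L) fun z => z + η • F z := by
  intro x y
  have hFxy : -(L * ‖x - y‖ ^ 2) ≤ inner ℝ (F x - F y) (x - y) := by
    refine neg_le_of_neg_le ((neg_le_abs _).trans ((abs_real_inner_le_norm _ _).trans ?_))
    rw [sq, ← mul_assoc]
    gcongr
    exact hF.norm_sub_le x y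
  have hη_mul := mul_le_mul_of_nonneg_left hFxy hη
  rw [add_sub_add_comm, ← smul_sub, inner_add_left, real_inner_smul_left,
    real_inner_self_eq_norm_sq]
  linarith

theorem IsMaximallyMonotone.lipschitzWith_operatorResolvent_sumOperator [CompleteSpace E]
    {G : E → Set E} (hG : IsMaximallyMonotone G) {F : E → E} {L : ℝ≥0} (hF : LipschitzWith L F)
    {η : ℝ} (hη : 0 < η) (hηL : η * L < 1) :
    LipschitzWith (1 - η * L)⁻¹.toNNReal
      (operatorResolvent (scaleOperator η (sumOperator F G))) := by
  have hμ : 0 < 1 - η * L := sub_pos.2 hηL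
  set J := operatorResolvent (scaleOperator η (sumOperator F G))
  have hJ : ∀ x, IsResolventValue (scaleOperator η G) (x - η • F (J x)) (J x) := fun x =>
    isResolventValue_scaleOperator_sumOperator_iff.1
      (hG.isResolventValue_operatorResolvent_sumOperator hF hη hηL x)
  refine LipschitzWith.of_dist_le_mul fun x y => ?_
  have hmono : inner ℝ (J x + η • F (J x) - (J y + η • F (J y))) (J x - J y) ≤
      inner ℝ (x - y) (J x - J y) := by
    rw [← sub_nonneg, ← inner_sub_left]
    convert (hG.1.scale hη.le) _ _ _ (hJ x) _ (hJ y) using 2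
    abel
  have hinner := ((isStronglyMonotone_id_add_smul hF hη.le (J x) (J y)).trans hmono).trans
    (real_inner_le_norm _ _)
  rw [Real.coe_toNNReal _ (by positivity), dist_eq_norm, dist_eq_norm, inv_mul_eq_div,
    le_div_iff₀' hμ]
  rcases (norm_nonneg (J x - J y)).eq_or_lt with hzero | hpos
  · rw [← hzero, mul_zero]
    positivity
  · exact le_of_mul_le_mul_right (by linarith) hpos

end Cohypomonotone

section HalpernPotential

variable {E : Type*} [NormedAddCommGroup E] [InnerProductSpace ℝ E]

/-- The Lyapunov function of Halpern's iteration with anchoring weight `1 / (n + 1)`, where `s` is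
the residual at the current point and `a` the displacement of that point from the anchor. -/
noncomputable def halpernPotential (n : ℝ) (s a : E) : ℝ :=
  (n - 1) * n / 2 * ‖s‖ ^ 2 + n * inner ℝ s a

theorem halpernPotential_add_one_le_add_inner {s s' a a' e : E} {n : ℝ} (hn : 0 < n)
    (ha : a' = (n / (n + 1)) • (a - s + e)) (hs : ‖s' - s‖ ^ 2 ≤ inner ℝ (s' - s) (a' - a)) :
    halpernPotential (n + 1) s' a' ≤
      halpernPotential n s a + n * (n + 1) / 2 * ‖e‖ ^ 2 + n * inner ℝ e s := by
  have hcoc : 0 ≤ n * (n + 1) * (inner ℝ (s' - s) (a' - a) - ‖s' - s‖ ^ 2) :=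
    mul_nonneg (by positivity) (by linarith)
  have hsq : 0 ≤ n * (n + 1) / 2 * ‖s' - s - e‖ ^ 2 := by positivity
  rw [← sub_nonneg]
  refine (add_nonneg hcoc hsq).trans_eq ?_
  simp only [halpernPotential, ha, ← real_inner_self_eq_norm_sq, inner_sub_left, inner_sub_right,
    inner_add_right, real_inner_smul_right]
  rw [real_inner_comm s' s, real_inner_comm s e, real_inner_comm s' e]
  field_simp
  ring

theorem halpernPotential_add_one_le {s s' a a' e : E} {n : ℝ} (hn : 0 < n)
    (ha : a' = (n / (n + 1)) • (a - s + e)) (hs : ‖s' - s‖ ^ 2 ≤ inner ℝ (s' - s) (a' - a)) :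
    halpernPotential (n + 1) s' a' ≤
      halpernPotential n s a + 5 * (n * (n + 1)) * ‖e‖ ^ 2 + n / (n + 1) / 18 * ‖s‖ ^ 2 := by
  have hyoung : inner ℝ e s ≤ 9 / 2 * (n + 1) * ‖e‖ ^ 2 + 1 / (18 * (n + 1)) * ‖s‖ ^ 2 := by
    have hsq : 9 / 2 * (n + 1) * ‖e‖ ^ 2 + 1 / (18 * (n + 1)) * ‖s‖ ^ 2 - ‖e‖ * ‖s‖ =
        (9 * (n + 1) * ‖e‖ - ‖s‖) ^ 2 / (18 * (n + 1)) := by field_simp; ring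
    have : 0 ≤ (9 * (n + 1) * ‖e‖ - ‖s‖) ^ 2 / (18 * (n + 1)) := by positivity
    linarith [real_inner_le_norm e s]
  calc halpernPotential (n + 1) s' a'
      ≤ halpernPotential n s a + n * (n + 1) / 2 * ‖e‖ ^ 2 + n * inner ℝ e s :=
        halpernPotential_add_one_le_add_inner hn ha hs
    _ ≤ halpernPotential n s a + n * (n + 1) / 2 * ‖e‖ ^ 2
          + n * (9 / 2 * (n + 1) * ‖e‖ ^ 2 + 1 / (18 * (n + 1)) * ‖s‖ ^ 2) := by gcongr
    _ = halpernPotential n s a + 5 * (n * (n + 1)) * ‖e‖ ^ 2 + n / (n + 1) / 18 * ‖s‖ ^ 2 := by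
        field_simp
        ring

/-- If `s` is the residual of a firmly nonexpansive map at a point `x`, then `c` is the anchor minus
a zero of the map, and `a + c` is `x` minus that zero. -/
theorem mul_norm_sq_le_add_halpernPotential {s a c : E} {n : ℝ} (hn : 0 < n)
    (hs : ‖s‖ ^ 2 ≤ inner ℝ s (a + c)) :
    n * (n + 1) / 4 * ‖s‖ ^ 2 ≤ ‖c‖ ^ 2 + halpernPotential n s a := by
  have hyoung : n * (‖s‖ * ‖c‖) ≤ n * (n + 1) / 4 * ‖s‖ ^ 2 + ‖c‖ ^ 2 := by
    have hsq : n * (n + 1) / 4 * ‖s‖ ^ 2 + ‖c‖ ^ 2 - n * (‖s‖ * ‖c‖) =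
        n * ((n + 1) * ‖s‖ - 2 * ‖c‖) ^ 2 / (4 * (n + 1)) + ‖c‖ ^ 2 / (n + 1) := by
      field_simp
      ring
    have : 0 ≤ n * ((n + 1) * ‖s‖ - 2 * ‖c‖) ^ 2 / (4 * (n + 1)) + ‖c‖ ^ 2 / (n + 1) := by
      positivity
    linarith
  rw [inner_add_right] at hs
  have hinner := mul_le_mul_of_nonneg_left (hs.trans (add_le_add_right (real_inner_le_norm s c) _))
    hn.le
  rw [halpernPotential]
  linarith

theorem sum_range_inv_add_two_sq_le (k : ℕ) :
    ∑ j ∈ Finset.range k, 1 / ((j : ℝ) + 2) ^ 2 ≤ 1 := by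
  have hterm : ∀ j ∈ Finset.range k,
      1 / ((j : ℝ) + 2) ^ 2 ≤ 1 / ((j : ℝ) + 1) - 1 / (((j + 1 : ℕ) : ℝ) + 1) := fun j _ => by
    rw [div_sub_div _ _ (by positivity) (by positivity), div_le_div_iff₀ (by positivity)
      (by positivity)]
    push_cast
    nlinarith [(j.cast_nonneg : (0 : ℝ) ≤ j)]
  refine (Finset.sum_le_sum hterm).trans ?_
  rw [Finset.sum_range_sub' fun j : ℕ => 1 / ((j : ℝ) + 1)]
  have : 0 ≤ 1 / ((k : ℝ) + 1) := by positivity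
  norm_num at this ⊢
  linarith

theorem one_div_mul_log_sq_le {x : ℝ} (hx : 2 ≤ x) :
    1 / ((x + 1) * Real.log (x + 1) ^ 2) ≤ 1 / Real.log x - 1 / Real.log (x + 1) := by
  have ha : 0 < Real.log x := Real.log_pos (by linarith)
  have hab : Real.log x ≤ Real.log (x + 1) := Real.log_le_log (by linarith) (by linarith)
  have hdiff : 1 / (x + 1) ≤ Real.log (x + 1) - Real.log x := by
    rw [← Real.log_div (by linarith) (by linarith)]
    refine (le_of_eq ?_).trans (Real.one_sub_inv_le_log_of_pos (by positivity))
    field_simp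
    ring
  have hb : 0 < Real.log (x + 1) := ha.trans_le hab
  have hpos : 0 ≤ 1 / (x + 1) := by positivity
  calc 1 / ((x + 1) * Real.log (x + 1) ^ 2) = 1 / (x + 1) / Real.log (x + 1) ^ 2 := by
        rw [div_div]
    _ ≤ (Real.log (x + 1) - Real.log x) / (Real.log x * Real.log (x + 1)) :=
        div_le_div₀ (hpos.trans hdiff) hdiff (by positivity) (by nlinarith)
    _ = 1 / Real.log x - 1 / Real.log (x + 1) := by field_simp

theorem log_add_two_pos (k : ℕ) : 0 < Real.log ((k : ℝ) + 2) :=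
  Real.log_pos (by linarith [(k.cast_nonneg : (0 : ℝ) ≤ k)])

theorem sum_range_inv_mul_log_sq_le (k : ℕ) :
    ∑ j ∈ Finset.range k, 1 / (((j : ℝ) + 2) * Real.log ((j : ℝ) + 2) ^ 2) ≤ 5 / 2 := by
  have hterm : ∀ j ∈ Finset.range k,
      1 / ((((j + 1 : ℕ) : ℝ) + 2) * Real.log (((j + 1 : ℕ) : ℝ) + 2) ^ 2) ≤
        1 / Real.log ((j : ℝ) + 2) - 1 / Real.log (((j + 1 : ℕ) : ℝ) + 2) := fun j _ => by
    push_cast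
    rw [add_right_comm]
    exact one_div_mul_log_sq_le (by linarith [(j.cast_nonneg : (0 : ℝ) ≤ j)])
  have hlast := one_div_nonneg.2 (log_add_two_pos k).le
  have hlog : (0.6931 : ℝ) < Real.log 2 := by linarith [Real.log_two_gt_d9]
  have hfirst : 1 / (2 * Real.log 2 ^ 2) ≤ 1.05 :=
    (show _ ≤ 1 / (2 * (0.6931 : ℝ) ^ 2) by gcongr).trans (by norm_num)
  have htele : 1 / Real.log 2 ≤ 1.45 :=
    (show _ ≤ 1 / (0.6931 : ℝ) by gcongr).trans (by norm_num)
  calc ∑ j ∈ Finset.range k, 1 / (((j : ℝ) + 2) * Real.log ((j : ℝ) + 2) ^ 2)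
      ≤ ∑ j ∈ Finset.range (k + 1), 1 / (((j : ℝ) + 2) * Real.log ((j : ℝ) + 2) ^ 2) :=
        Finset.sum_le_sum_of_subset_of_nonneg (Finset.range_mono k.le_succ)
          fun j _ _ => by positivity
    _ ≤ 1 / Real.log 2 - 1 / Real.log ((k : ℝ) + 2) + 1 / (2 * Real.log 2 ^ 2) := by
        rw [Finset.sum_range_succ']
        refine add_le_add ((Finset.sum_le_sum hterm).trans_eq ?_) (by norm_num)
        rw [Finset.sum_range_sub' fun j : ℕ => 1 / Real.log ((j : ℝ) + 2), Nat.cast_zero, zero_add]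
    _ ≤ 5 / 2 := by linarith

theorem halpern_inner_error_le {e c : ℝ} (hc : 0 ≤ c) (k : ℕ)
    (he : e ≤ 78 * c / (1734 * ((k : ℝ) + 2) ^ 3 * Real.log ((k : ℝ) + 2) ^ 2)) :
    5 * (((k : ℝ) + 1) * (k + 2)) * e ≤
      c * (1 / (((k : ℝ) + 2) * Real.log ((k : ℝ) + 2) ^ 2)) := by
  have hlog := log_add_two_pos k
  calc 5 * (((k : ℝ) + 1) * (k + 2)) * e
      ≤ 5 * (((k : ℝ) + 2) * (k + 2)) *
        (78 * c / (1734 * ((k : ℝ) + 2) ^ 3 * Real.log ((k : ℝ) + 2) ^ 2)) :=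
        mul_le_mul_of_nonneg (by gcongr; norm_num) he (by positivity) (by positivity)
    _ = (390 / 1734) * (c * (1 / (((k : ℝ) + 2) * Real.log ((k : ℝ) + 2) ^ 2))) := by
        field_simp
        ring
    _ ≤ _ := mul_le_of_le_one_left (by positivity) (by norm_num)

/-- `M`, `V` and `e` are the expected squared residuals, potentials and squared errors of an inexact
Halpern iteration. The error tolerance makes the increments of `V` summable. -/
theorem halpern_recursion_le {M V e : ℕ → ℝ} {D s : ℝ} (hD : 0 ≤ D) (hs : 0 ≤ s)
    (hV0 : V 0 = 0)
    (hV : ∀ k : ℕ, V (k + 1) ≤ V k + 5 * (((k : ℝ) + 1) * (k + 2)) * e k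
      + (k + 1) / (k + 2) / 18 * M k)
    (hM : ∀ k : ℕ, ((k : ℝ) + 1) * (k + 2) / 4 * M k ≤ D + V k)
    (he : ∀ k : ℕ, e k ≤
      (3 * M k + 24 * s) / (1734 * ((k : ℝ) + 2) ^ 3 * Real.log ((k : ℝ) + 2) ^ 2)) (k : ℕ) :
    M k ≤ 36 * (D + s) / ((k + 1) * (k + 2)) := by
  let w : ℕ → ℝ := fun j => 1 / (((j : ℝ) + 2) * Real.log ((j : ℝ) + 2) ^ 2)
    + 2 * (1 / ((j : ℝ) + 2) ^ 2)
  have hw : ∀ k, ∑ j ∈ Finset.range k, w j ≤ 8 := fun k => by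
    rw [Finset.sum_add_distrib, ← Finset.mul_sum]
    linarith [sum_range_inv_mul_log_sq_le k, sum_range_inv_add_two_sq_le k]
  have hM_of_V : ∀ k, V k ≤ (D + s) * ∑ j ∈ Finset.range k, w j →
      M k ≤ 36 * (D + s) / ((k + 1) * (k + 2)) := fun k hk => by
    have := mul_le_mul_of_nonneg_left (hw k) (add_nonneg hD hs)
    rw [le_div_iff₀ (by positivity)]
    linarith [hM k]
  refine hM_of_V k ?_
  induction k with
  | zero => simp [hV0]
  | succ k ih =>
    have hMk := hM_of_V k ih
    have hMk18 : M k ≤ 18 * (D + s) := by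
      refine hMk.trans ((div_le_iff₀ (by positivity)).2 ?_)
      have hk : (2 : ℝ) ≤ (k + 1) * (k + 2) := by nlinarith [(k.cast_nonneg : (0 : ℝ) ≤ k)]
      nlinarith [mul_le_mul_of_nonneg_left hk (add_nonneg hD hs)]
    have herror := halpern_inner_error_le (add_nonneg hD hs) k <| (he k).trans <|
      div_le_div_of_nonneg_right (show 3 * M k + 24 * s ≤ 78 * (D + s) by linarith)
        (by positivity)
    have hresidual : ((k : ℝ) + 1) / (k + 2) / 18 * M k ≤
        (D + s) * (2 * (1 / ((k : ℝ) + 2) ^ 2)) := by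
      refine (mul_le_mul_of_nonneg_left hMk (by positivity)).trans_eq ?_
      field_simp
      ring
    rw [Finset.sum_range_succ, mul_add, mul_add (D + s) (1 / _)]
    linarith [hV k]

end HalpernPotential

theorem norm_sub_sq_le_of_lipschitzWith {F : Type*} [NormedAddCommGroup F]
    {B : F → F} {L : ℝ≥0} (hB : LipschitzWith L B) (x y b b' : F) :
    ‖b - b'‖ ^ 2 ≤ 3 * (L ^ 2 * ‖x - y‖ ^ 2 + ‖b - B x‖ ^ 2 + ‖b' - B y‖ ^ 2) := by
  have hnorm : ‖b - b'‖ ≤ L * ‖x - y‖ + ‖b - B x‖ + ‖b' - B y‖ := by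
    have hsplit : b - b' = (B x - B y) + ((b - B x) - (b' - B y)) := by abel
    rw [hsplit]
    linarith [norm_add_le (B x - B y) ((b - B x) - (b' - B y)),
      norm_sub_le (b - B x) (b' - B y), hB.norm_sub_le x y]
  have hsq : ‖b - b'‖ ^ 2 ≤ (L * ‖x - y‖ + ‖b - B x‖ + ‖b' - B y‖) ^ 2 := by gcongr
  nlinarith [sq_nonneg (L * ‖x - y‖ - ‖b - B x‖), sq_nonneg (L * ‖x - y‖ - ‖b' - B y‖),
    sq_nonneg (‖b - B x‖ - ‖b' - B y‖)]

section FBFStep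

variable {E : Type*} [NormedAddCommGroup E] [InnerProductSpace ℝ E]

/-- One step of forward-backward-forward from `z` through the half step `h`, with `b` and `b'` in
place of `B z` and `B h`, towards a zero `zs` of `A + B`. -/
theorem norm_fbf_step_sub_sq_le {A : E → Set E} (hA : IsMonotoneOperator A) {B : E → E}
    {LB : ℝ≥0} (hB : LipschitzWith LB B) {μ : ℝ} (hBμ : IsStronglyMonotone μ B) (hμ : 0 ≤ μ)
    (hμL : μ ≤ LB) {τ : ℝ} (hτ : 0 ≤ τ) (hτL : 3 * τ * LB ≤ 1) {z h zs b b' : E}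
    (hzs : -B zs ∈ A zs) (hh : IsResolventValue (scaleOperator τ A) (z - τ • b) h) :
    ‖h + τ • b - τ • b' - zs‖ ^ 2 ≤
      (1 - τ * μ) * ‖z - zs‖ ^ 2 - 2 * τ * inner ℝ (b' - B h) (h - zs)
        + 3 * τ ^ 2 * (‖b - B z‖ ^ 2 + ‖b' - B h‖ ^ 2) := by
  have hmono : 0 ≤ inner ℝ (z - h) (h - zs) - τ * inner ℝ (b - b') (h - zs)
      - τ * inner ℝ (B h - B zs) (h - zs) - τ * inner ℝ (b' - B h) (h - zs) := by
    have hinner := (hA.scale hτ) h zs _ hh _ ⟨_, hzs, rfl⟩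
    simp only [← real_inner_smul_left, ← inner_sub_left]
    convert hinner using 2
    module
  have hz_sq : ‖z - zs‖ ^ 2 ≤ 2 * ‖z - h‖ ^ 2 + 2 * ‖h - zs‖ ^ 2 := by
    rw [← sub_add_sub_cancel z h zs, ← mul_add]
    exact (pow_le_pow_left₀ (norm_nonneg _) (norm_add_le _ _) 2).trans add_sq_le
  have hτL_sq : 3 * τ ^ 2 * LB ^ 2 ≤ 1 / 3 := by
    have : (3 * τ * LB) ^ 2 ≤ 1 := pow_le_one₀ (by positivity) hτL
    linarith
  have hτμ : 3 * (τ * μ) ≤ 1 := by nlinarith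
  have hb_step := mul_le_mul_of_nonneg_left
    (norm_sub_sq_le_of_lipschitzWith hB z h b b') (sq_nonneg τ)
  have hz_step := mul_le_mul_of_nonneg_left hz_sq (mul_nonneg hτ hμ)
  have hstrong := mul_le_mul_of_nonneg_left (hBμ h zs) hτ
  have hLip_step := mul_le_mul_of_nonneg_right hτL_sq (sq_nonneg ‖z - h‖)
  have hμ_step := mul_le_mul_of_nonneg_right hτμ (sq_nonneg ‖z - h‖)
  calc ‖h + τ • b - τ • b' - zs‖ ^ 2
      = ‖(h - zs) + τ • (b - b')‖ ^ 2 := by congr 2; module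
    _ = ‖h - zs‖ ^ 2 + 2 * (τ * inner ℝ (b - b') (h - zs)) + τ ^ 2 * ‖b - b'‖ ^ 2 := by
        rw [norm_add_sq_real, real_inner_smul_right, norm_smul, mul_pow, Real.norm_eq_abs, sq_abs,
          real_inner_comm]
    _ ≤ ‖z - h‖ ^ 2 + 2 * inner ℝ (z - h) (h - zs) + ‖h - zs‖ ^ 2 - τ * μ * ‖z - zs‖ ^ 2
          - 2 * τ * inner ℝ (b' - B h) (h - zs)
          + 3 * τ ^ 2 * (‖b - B z‖ ^ 2 + ‖b' - B h‖ ^ 2) := by linarith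
    _ = _ := by
        rw [← norm_add_sq_real, sub_add_sub_cancel]
        ring

end FBFStep

/-- The weights `(t + κ) (t + κ - 1)` make the recursion telescope. -/
theorem fbf_weighted_recursion_le {d : ℕ → ℝ} {μ κ s : ℝ} (hμ : 0 < μ) (hκ : 1 ≤ κ) (hs : 0 ≤ s)
    (hd : ∀ t : ℕ, d (t + 1) ≤ (1 - 2 / (μ * (t + 1 + κ)) * μ) * d t
      + 6 * (2 / (μ * (t + 1 + κ))) ^ 2 * s) (N : ℕ) :
    (N + κ) * (N + κ - 1) * d N ≤ κ * (κ - 1) * d 0 + 24 * s / μ ^ 2 * N := by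
  induction N with
  | zero => simp
  | succ t ih =>
    have hpos : (0 : ℝ) < t + 1 + κ := by positivity
    have hratio : 24 * s / μ ^ 2 * ((t + κ) / (t + 1 + κ)) ≤ 24 * s / μ ^ 2 * 1 := by
      gcongr
      rw [div_le_one hpos]
      linarith
    calc (↑(t + 1) + κ) * (↑(t + 1) + κ - 1) * d (t + 1)
        = (t + 1 + κ) * (t + κ) * d (t + 1) := by push_cast; ring
      _ ≤ (t + 1 + κ) * (t + κ) * ((1 - 2 / (μ * (t + 1 + κ)) * μ) * d t
            + 6 * (2 / (μ * (t + 1 + κ))) ^ 2 * s) := by gcongr; exact hd t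
      _ = (t + κ) * (t + κ - 1) * d t + 24 * s / μ ^ 2 * ((t + κ) / (t + 1 + κ)) := by
          field_simp
          ring
      _ ≤ κ * (κ - 1) * d 0 + 24 * s / μ ^ 2 * ↑(t + 1) := by
          push_cast
          linarith

theorem fbf_recursion_le {d : ℕ → ℝ} {μ LB s : ℝ} (hμ : 0 < μ) (hμL : μ ≤ LB) (hs : 0 ≤ s)
    (hd0 : 0 ≤ d 0)
    (hd : ∀ t : ℕ, d (t + 1) ≤ (1 - 2 / (((t : ℝ) + 1) * μ + 6 * LB) * μ) * d t
      + 6 * (2 / (((t : ℝ) + 1) * μ + 6 * LB)) ^ 2 * s) {N : ℕ} (hN : 0 < N) :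
    d N ≤ (3 / 2 * (LB * μ) * d 0 + 24 * s) / (μ ^ 2 * N) := by
  obtain ⟨κ, rfl⟩ : ∃ κ, LB = μ * κ / 6 := ⟨6 * LB / μ, by field_simp⟩
  have hκ : 6 ≤ κ := le_of_mul_le_mul_left (by linarith) hμ
  have hweighted := fbf_weighted_recursion_le hμ (by linarith) hs (fun t => by
    convert hd t using 5 <;> ring) N
  have hN1 : (1 : ℝ) ≤ N := by exact_mod_cast hN
  have hpos : (0 : ℝ) < (N + κ) * (N + κ - 1) := mul_pos (by linarith) (by linarith)
  have hinitial : 4 * (κ - 1) * N ≤ (N + κ) * (N + κ - 1) := by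
    nlinarith [sq_nonneg ((N : ℝ) - κ + 3 / 2)]
  have hnoise : (N : ℝ) ^ 2 ≤ (N + κ) * (N + κ - 1) := by nlinarith
  rw [le_div_iff₀ (by positivity)]
  refine le_of_mul_le_mul_left ?_ hpos
  calc (N + κ) * (N + κ - 1) * (d N * (μ ^ 2 * N))
      = (N + κ) * (N + κ - 1) * d N * (μ ^ 2 * N) := by ring
    _ ≤ (κ * (κ - 1) * d 0 + 24 * s / μ ^ 2 * N) * (μ ^ 2 * N) := by gcongr
    _ = κ * μ ^ 2 / 4 * d 0 * (4 * (κ - 1) * N) + 24 * s * N ^ 2 := by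
        field_simp
    _ ≤ κ * μ ^ 2 / 4 * d 0 * ((N + κ) * (N + κ - 1)) + 24 * s * ((N + κ) * (N + κ - 1)) := by
        gcongr
    _ = (N + κ) * (N + κ - 1) * (3 / 2 * (μ * κ / 6 * μ) * d 0 + 24 * s) := by ring

section SquareIntegrable

variable {Ω E E' : Type*} [MeasurableSpace Ω] {Pr : Measure Ω} [NormedAddCommGroup E]

theorem integrable_inner_of_memLp_two [InnerProductSpace ℝ E] {f g : Ω → E} (hf : MemLp f 2 Pr)
    (hg : MemLp g 2 Pr) : Integrable (fun ω => inner ℝ (f ω) (g ω)) Pr :=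
  (hf.norm.integrable_mul hg.norm).mono (hf.1.inner hg.1)
    (ae_of_all _ fun ω => by simpa using norm_inner_le_norm (𝕜 := ℝ) (f ω) (g ω))

theorem memLp_comp_of_lipschitzWith [NormedAddCommGroup E'] [IsFiniteMeasure Pr] {K : ℝ≥0}
    {p : ℝ≥0∞} {g : E → E'} (hg : LipschitzWith K g) {f : Ω → E} (hf : MemLp f p Pr) :
    MemLp (fun ω => g (f ω)) p Pr := by
  have hg0 : LipschitzWith K fun x => g x - g 0 := by simpa using hg.sub (LipschitzWith.const (g 0))
  convert (hg0.comp_memLp (sub_self _) hf).add (memLp_const (g 0)) using 1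
  funext ω
  exact (sub_add_cancel _ _).symm

theorem sq_integral_le_integral_sq [IsProbabilityMeasure Pr] {f : Ω → ℝ} (hf : MemLp f 2 Pr) :
    (∫ ω, f ω ∂Pr) ^ 2 ≤ ∫ ω, f ω ^ 2 ∂Pr := by
  have hvar := variance_nonneg f Pr
  rw [variance_eq_sub hf, sub_nonneg] at hvar
  exact hvar

end SquareIntegrable

theorem isProbabilityMeasure_of_measurePreserving {Ω S : Type*} [MeasurableSpace Ω]
    [MeasurableSpace S] {Pr : Measure Ω} [IsProbabilityMeasure Pr] {P : Measure S} {s : Ω → S}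
    (hs : MeasurePreserving s Pr P) : IsProbabilityMeasure P :=
  hs.map_eq ▸ Measure.isProbabilityMeasure_map hs.aemeasurable

namespace IsStochasticOracle

variable {Ω S E : Type*} [MeasurableSpace Ω] [MeasurableSpace S] {Pr : Measure Ω}
  [IsProbabilityMeasure Pr] {P : Measure S} [NormedAddCommGroup E] [InnerProductSpace ℝ E]
  [MeasurableSpace E] {F : E → E} {Ft : E → S → E} {σ : ℝ} {s : Ω → S} {X Y : Ω → E}

theorem integral_inner_sub_mean [CompleteSpace E] [IsProbabilityMeasure P]
    (hO : IsStochasticOracle P F Ft σ) (x y : E) :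
    ∫ s, inner ℝ (Ft x s - F x) y ∂P = 0 := by
  have hcentered : Integrable (fun s => Ft x s - F x) P :=
    (hO.integrable x).sub (integrable_const _)
  have hmean : ∫ s, (Ft x s - F x) ∂P = 0 := by
    rw [integral_sub (hO.integrable x) (integrable_const _), hO.unbiased]
    simp
  simp_rw [real_inner_comm y]
  rw [integral_inner hcentered, hmean, inner_zero_right]

variable [SecondCountableTopology E] [BorelSpace E]

theorem id_add_smul [CompleteSpace E] [IsProbabilityMeasure P]
    (hO : IsStochasticOracle P F Ft σ) (η : ℝ) :
    IsStochasticOracle P (fun z => z + η • F z) (fun z s => z + η • Ft z s) (η * σ) where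
  measurable := measurable_fst.add (hO.measurable.const_smul η)
  integrable z := (integrable_const z).add ((hO.integrable z).smul η)
  unbiased z := by
    have hsum := integral_add (integrable_const z) ((hO.integrable z).smul η)
    simpa [integral_smul, hO.unbiased] using hsum
  variance_le z := by
    have hnoise : ∀ s, ‖z + η • Ft z s - (z + η • F z)‖ₑ ^ 2 = ‖η‖ₑ ^ 2 * ‖Ft z s - F z‖ₑ ^ 2 :=
      fun s => by rw [add_sub_add_left_eq_sub, ← smul_sub, enorm_smul, mul_pow]
    have hη : ‖η‖ₑ ^ 2 = ENNReal.ofReal (η ^ 2) := by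
      rw [← enorm_pow, Real.enorm_of_nonneg (sq_nonneg η)]
    simp only [hnoise]
    rw [lintegral_const_mul' _ _ (by simp), mul_pow, ENNReal.ofReal_mul (sq_nonneg η), hη]
    gcongr
    exact hO.variance_le z

theorem measurable_mean [SFinite P] (hO : IsStochasticOracle P F Ft σ) : Measurable F := by
  rw [show F = fun x => ∫ s, Ft x s ∂P from funext fun x => (hO.unbiased x).symm]
  exact hO.measurable.stronglyMeasurable.integral_prod_right.measurable

section Noise

variable (hO : IsStochasticOracle P F Ft σ) (hs : MeasurePreserving s Pr P) (hX : Measurable X)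
  (hXs : IndepFun X s Pr)

include hO hs hX hXs

theorem lintegral_noise_sq_le :
    ∫⁻ ω, ‖Ft (X ω) (s ω) - F (X ω)‖ₑ ^ 2 ∂Pr ≤ ENNReal.ofReal (σ ^ 2) := by
  have := isProbabilityMeasure_of_measurePreserving hs
  have := Measure.isProbabilityMeasure_map hX.aemeasurable (μ := Pr)
  have hnoise : Measurable fun p : E × S => ‖Ft p.1 p.2 - F p.1‖ₑ ^ 2 :=
    (hO.measurable.sub (hO.measurable_mean.comp measurable_fst)).enorm.pow_const 2
  calc ∫⁻ ω, ‖Ft (X ω) (s ω) - F (X ω)‖ₑ ^ 2 ∂Pr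
      = ∫⁻ p, ‖Ft p.1 p.2 - F p.1‖ₑ ^ 2 ∂((Pr.map X).prod P) := by
        rw [← hs.map_eq, ← (indepFun_iff_map_prod_eq_prod_map_map hX.aemeasurable
          hs.aemeasurable).1 hXs, lintegral_map hnoise (hX.prodMk hs.measurable)]
    _ = ∫⁻ x, ∫⁻ s, ‖Ft x s - F x‖ₑ ^ 2 ∂P ∂(Pr.map X) := lintegral_prod _ hnoise.aemeasurable
    _ ≤ ∫⁻ _, ENNReal.ofReal (σ ^ 2) ∂(Pr.map X) := lintegral_mono hO.variance_le
    _ = ENNReal.ofReal (σ ^ 2) := by simp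

theorem memLp_noise : MemLp (fun ω => Ft (X ω) (s ω) - F (X ω)) 2 Pr := by
  have := isProbabilityMeasure_of_measurePreserving hs
  have hmeas : Measurable fun ω => Ft (X ω) (s ω) - F (X ω) :=
    (hO.measurable.comp (hX.prodMk hs.measurable)).sub (hO.measurable_mean.comp hX)
  refine ⟨hmeas.aestronglyMeasurable, ?_⟩
  rw [eLpNorm_lt_top_iff_lintegral_rpow_enorm_lt_top (by norm_num) (by norm_num)]
  simpa using (hO.lintegral_noise_sq_le hs hX hXs).trans_lt ENNReal.ofReal_lt_top

theorem integral_norm_noise_sq_le : ∫ ω, ‖Ft (X ω) (s ω) - F (X ω)‖ ^ 2 ∂Pr ≤ σ ^ 2 := by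
  have hnoise := hO.memLp_noise hs hX hXs
  rw [integral_eq_lintegral_of_nonneg_ae (ae_of_all _ fun _ => by positivity)
    (hnoise.1.norm.aemeasurable.pow_const 2).aestronglyMeasurable]
  refine ENNReal.toReal_le_of_le_ofReal (sq_nonneg σ) ?_
  simpa [ENNReal.ofReal_pow] using hO.lintegral_noise_sq_le hs hX hXs

end Noise

theorem integral_inner_noise_eq_zero [CompleteSpace E] (hO : IsStochasticOracle P F Ft σ)
    (hs : MeasurePreserving s Pr P) (hX : Measurable X) (hY : Measurable Y)
    (hXYs : IndepFun (fun ω => (X ω, Y ω)) s Pr) (hY2 : MemLp Y 2 Pr) :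
    ∫ ω, inner ℝ (Ft (X ω) (s ω) - F (X ω)) (Y ω) ∂Pr = 0 := by
  have := isProbabilityMeasure_of_measurePreserving hs
  have hXY := hX.prodMk hY
  have := Measure.isProbabilityMeasure_map hXY.aemeasurable (μ := Pr)
  let g : (E × E) × S → ℝ := fun p => inner ℝ (Ft p.1.1 p.2 - F p.1.1) p.1.2
  have hg : Measurable g :=
    ((hO.measurable.comp (measurable_fst.fst.prodMk measurable_snd)).sub
      (hO.measurable_mean.comp measurable_fst.fst)).inner measurable_fst.snd
  have hmap : (Pr.map fun ω => ((X ω, Y ω), s ω)) = (Pr.map fun ω => (X ω, Y ω)).prod P := by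
    rw [← hs.map_eq]
    exact (indepFun_iff_map_prod_eq_prod_map_map hXY.aemeasurable hs.aemeasurable).1 hXYs
  have hpair := (hXY.prodMk hs.measurable).aemeasurable (μ := Pr)
  have hint : Integrable g ((Pr.map fun ω => (X ω, Y ω)).prod P) := by
    rw [← hmap, integrable_map_measure hg.aestronglyMeasurable hpair]
    exact integrable_inner_of_memLp_two
      (hO.memLp_noise hs hX (hXYs.comp measurable_fst measurable_id)) hY2
  calc ∫ ω, inner ℝ (Ft (X ω) (s ω) - F (X ω)) (Y ω) ∂Pr
      = ∫ p, g p ∂((Pr.map fun ω => (X ω, Y ω)).prod P) := by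
        rw [← hmap, integral_map hpair hg.aestronglyMeasurable]
    _ = 0 := by
      rw [integral_prod _ hint]
      exact integral_eq_zero_of_ae (ae_of_all _ fun p => hO.integral_inner_sub_mean p.1 p.2)

end IsStochasticOracle

section PastSeeds

variable {Ω S β : Type*} [MeasurableSpace S] [MeasurableSpace β]

/-- The σ-algebra generated by the seeds with index less than `n`: an event belongs to it when it is
determined by the oracle calls that precede the `n`-th one (calls are numbered from `0`). -/
@[reducible]
def pastSeeds (ξ : ℕ → Ω → S) (n : ℕ) : MeasurableSpace Ω :=
  ⨆ i ∈ Set.Iio n, MeasurableSpace.comap (ξ i) inferInstance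

theorem pastSeeds_mono (ξ : ℕ → Ω → S) : Monotone (pastSeeds ξ) :=
  fun _ _ hmn => biSup_mono fun _ hi => lt_of_lt_of_le hi hmn

theorem measurable_pastSeeds_seed (ξ : ℕ → Ω → S) (n : ℕ) : Measurable[pastSeeds ξ (n + 1)] (ξ n) :=
  Measurable.of_comap_le <|
    le_iSup₂_of_le (f := fun i (_ : i ∈ Set.Iio (n + 1)) => MeasurableSpace.comap (ξ i) _)
      n n.lt_succ_self le_rfl

variable [MeasurableSpace Ω] {ξ : ℕ → Ω → S}

theorem pastSeeds_le (hξ : ∀ n, Measurable (ξ n)) (n : ℕ) : pastSeeds ξ n ≤ ‹MeasurableSpace Ω› :=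
  iSup₂_le fun i _ => (hξ i).comap_le

theorem indepFun_seed_of_measurable_pastSeeds {Pr : Measure Ω} (hξ : ∀ n, Measurable (ξ n))
    (hind : iIndepFun ξ Pr) {n : ℕ} {X : Ω → β} (hX : Measurable[pastSeeds ξ n] X) :
    IndepFun X (ξ n) Pr := by
  have hpast := indep_iSup_of_disjoint (fun i => (hξ i).comap_le) hind.iIndep
    (S := Set.Iio n) (T := {n}) (by simp)
  rw [iSup_singleton] at hpast
  exact indep_of_indep_of_le_left hpast hX.comap_le

end PastSeeds

/-- The random vector `X` is square integrable and determined by the first `n` seeds. -/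
structure IsAdaptedL2 {Ω S E : Type*} [MeasurableSpace Ω] [MeasurableSpace S]
    [NormedAddCommGroup E] [MeasurableSpace E] (ξ : ℕ → Ω → S) (Pr : Measure Ω) (n : ℕ)
    (X : Ω → E) : Prop where
  measurable : Measurable[pastSeeds ξ n] X
  memLp : MemLp X 2 Pr

namespace IsAdaptedL2

variable {Ω S E : Type*} [MeasurableSpace Ω] [MeasurableSpace S] {Pr : Measure Ω}
  [NormedAddCommGroup E] [MeasurableSpace E] {P : Measure S} {ξ : ℕ → Ω → S} {m n : ℕ}
  {X Y : Ω → E}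

theorem mono (hX : IsAdaptedL2 ξ Pr m X) (hmn : m ≤ n) : IsAdaptedL2 ξ Pr n X :=
  ⟨hX.measurable.mono (pastSeeds_mono ξ hmn) le_rfl, hX.memLp⟩

theorem const [IsFiniteMeasure Pr] (ξ : ℕ → Ω → S) (n : ℕ) (x : E) :
    IsAdaptedL2 ξ Pr n fun _ => x :=
  ⟨measurable_const, memLp_const x⟩

theorem measurable_of_measurable_seeds (hX : IsAdaptedL2 ξ Pr n X)
    (hξ : ∀ n, Measurable (ξ n)) : Measurable X :=
  hX.measurable.mono (pastSeeds_le hξ n) le_rfl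

theorem indepFun_seed (hX : IsAdaptedL2 ξ Pr n X) (hξ : ∀ n, Measurable (ξ n))
    (hind : iIndepFun ξ Pr) : IndepFun X (ξ n) Pr :=
  indepFun_seed_of_measurable_pastSeeds hξ hind hX.measurable

variable [BorelSpace E]

theorem comp_lipschitzWith [IsFiniteMeasure Pr] (hX : IsAdaptedL2 ξ Pr n X)
    {K : ℝ≥0} {g : E → E} (hg : LipschitzWith K g) : IsAdaptedL2 ξ Pr n fun ω => g (X ω) :=
  ⟨hg.continuous.measurable.comp hX.measurable, memLp_comp_of_lipschitzWith hg hX.memLp⟩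

theorem const_smul [NormedSpace ℝ E] (c : ℝ) (hX : IsAdaptedL2 ξ Pr n X) :
    IsAdaptedL2 ξ Pr n fun ω => c • X ω :=
  ⟨hX.measurable.const_smul c, hX.memLp.const_smul c⟩

variable [SecondCountableTopology E]

theorem add (hX : IsAdaptedL2 ξ Pr n X) (hY : IsAdaptedL2 ξ Pr n Y) :
    IsAdaptedL2 ξ Pr n fun ω => X ω + Y ω :=
  ⟨hX.measurable.add hY.measurable, hX.memLp.add hY.memLp⟩

theorem sub (hX : IsAdaptedL2 ξ Pr n X) (hY : IsAdaptedL2 ξ Pr n Y) :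
    IsAdaptedL2 ξ Pr n fun ω => X ω - Y ω :=
  ⟨hX.measurable.sub hY.measurable, hX.memLp.sub hY.memLp⟩

variable [InnerProductSpace ℝ E] [IsProbabilityMeasure Pr] {F : E → E} {Ft : E → S → E}
  {L : ℝ≥0} {σ : ℝ}

theorem memLp_noise (hX : IsAdaptedL2 ξ Pr n X) (hO : IsStochasticOracle P F Ft σ)
    (hξ : ∀ n, MeasurePreserving (ξ n) Pr P) (hind : iIndepFun ξ Pr) :
    MemLp (fun ω => Ft (X ω) (ξ n ω) - F (X ω)) 2 Pr :=
  have hξ_meas := fun n => (hξ n).measurable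
  hO.memLp_noise (hξ n) (hX.measurable_of_measurable_seeds hξ_meas) (hX.indepFun_seed hξ_meas hind)

theorem integral_norm_noise_sq_le (hX : IsAdaptedL2 ξ Pr n X) (hO : IsStochasticOracle P F Ft σ)
    (hξ : ∀ n, MeasurePreserving (ξ n) Pr P) (hind : iIndepFun ξ Pr) :
    ∫ ω, ‖Ft (X ω) (ξ n ω) - F (X ω)‖ ^ 2 ∂Pr ≤ σ ^ 2 :=
  have hξ_meas := fun n => (hξ n).measurable
  hO.integral_norm_noise_sq_le (hξ n) (hX.measurable_of_measurable_seeds hξ_meas)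
    (hX.indepFun_seed hξ_meas hind)

theorem integral_inner_noise_eq_zero [CompleteSpace E] (hX : IsAdaptedL2 ξ Pr n X)
    (hY : IsAdaptedL2 ξ Pr n Y) (hO : IsStochasticOracle P F Ft σ)
    (hξ : ∀ n, MeasurePreserving (ξ n) Pr P) (hind : iIndepFun ξ Pr) :
    ∫ ω, inner ℝ (Ft (X ω) (ξ n ω) - F (X ω)) (Y ω) ∂Pr = 0 :=
  have hξ_meas := fun n => (hξ n).measurable
  hO.integral_inner_noise_eq_zero (hξ n) (hX.measurable_of_measurable_seeds hξ_meas)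
    (hY.measurable_of_measurable_seeds hξ_meas)
    (indepFun_seed_of_measurable_pastSeeds hξ_meas hind (hX.measurable.prodMk hY.measurable))
    hY.memLp

theorem oracle (hX : IsAdaptedL2 ξ Pr n X) (hF : LipschitzWith L F)
    (hO : IsStochasticOracle P F Ft σ) (hξ : ∀ n, MeasurePreserving (ξ n) Pr P)
    (hind : iIndepFun ξ Pr) : IsAdaptedL2 ξ Pr (n + 1) fun ω => Ft (X ω) (ξ n ω) where
  measurable := hO.measurable.comp
    ((hX.mono n.le_succ).measurable.prodMk (measurable_pastSeeds_seed ξ n))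
  memLp := by
    convert (hX.memLp_noise hO hξ hind).add (hX.comp_lipschitzWith hF).memLp using 1
    funext ω
    exact (sub_add_cancel _ _).symm

end IsAdaptedL2

section StochasticFBF

variable {Ω S E : Type*} [MeasurableSpace Ω] [MeasurableSpace S] {Pr : Measure Ω}
  [IsProbabilityMeasure Pr] {P : Measure S} [NormedAddCommGroup E] [InnerProductSpace ℝ E]
  [CompleteSpace E] [SecondCountableTopology E] [MeasurableSpace E] [BorelSpace E]
  {ξ : ℕ → Ω → S} {A : E → Set E} {B : E → E} {Bt : E → S → E} {LB : ℝ≥0} {μ τ σ : ℝ} {n : ℕ}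

theorem integral_norm_fbf_step_sub_sq_le (hA : IsMonotoneOperator A) (hB : LipschitzWith LB B)
    (hBμ : IsStronglyMonotone μ B) (hμ : 0 ≤ μ) (hμL : μ ≤ LB) (hO : IsStochasticOracle P B Bt σ)
    (hξ : ∀ n, MeasurePreserving (ξ n) Pr P) (hind : iIndepFun ξ Pr) (hτ : 0 ≤ τ)
    (hτL : 3 * τ * LB ≤ 1) {x z h zs : Ω → E} (hz : IsAdaptedL2 ξ Pr n z)
    (hh : IsAdaptedL2 ξ Pr (n + 1) h) (hzs : IsAdaptedL2 ξ Pr n zs)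
    (hzs_zero : ∀ ω, x ω - B (zs ω) ∈ A (zs ω))
    (hh_resolvent : ∀ ω,
      IsResolventValue (scaleOperator τ A) (z ω - τ • (Bt (z ω) (ξ n ω) - x ω)) (h ω)) :
    ∫ ω, ‖h ω + τ • (Bt (z ω) (ξ n ω) - x ω) - τ • (Bt (h ω) (ξ (n + 1) ω) - x ω)
        - zs ω‖ ^ 2 ∂Pr ≤
      (1 - τ * μ) * ∫ ω, ‖z ω - zs ω‖ ^ 2 ∂Pr + 6 * τ ^ 2 * σ ^ 2 := by
  set ν : Ω → E := fun ω => Bt (z ω) (ξ n ω) - B (z ω)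
  set ν' : Ω → E := fun ω => Bt (h ω) (ξ (n + 1) ω) - B (h ω)
  have hstep := fun ω => norm_fbf_step_sub_sq_le hA (B := fun y => B y - x ω)
    (by simpa using hB.sub (.const _)) (by simpa [IsStronglyMonotone] using hBμ) hμ hμL hτ hτL
    (b' := Bt (h ω) (ξ (n + 1) ω) - x ω) (by simpa using hzs_zero ω) (hh_resolvent ω)
  simp only [sub_sub_sub_cancel_right] at hstep
  have hhz := hh.sub (hzs.mono n.le_succ)
  have hsq_int : Integrable (fun ω => (1 - τ * μ) * ‖z ω - zs ω‖ ^ 2) Pr :=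
    ((hz.sub hzs).memLp.integrable_norm_pow two_ne_zero).const_mul _
  have hinner_int : Integrable (fun ω => 2 * τ * inner ℝ (ν' ω) (h ω - zs ω)) Pr :=
    (integrable_inner_of_memLp_two (hh.memLp_noise hO hξ hind) hhz.memLp).const_mul _
  have hν_int : Integrable (fun ω => ‖ν ω‖ ^ 2) Pr :=
    (hz.memLp_noise hO hξ hind).integrable_norm_pow two_ne_zero
  have hν'_int : Integrable (fun ω => ‖ν' ω‖ ^ 2) Pr :=
    (hh.memLp_noise hO hξ hind).integrable_norm_pow two_ne_zero
  have hnoise_int := (hν_int.add hν'_int).const_mul (3 * τ ^ 2)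
  have hnoise : 3 * τ ^ 2 * (∫ ω, ‖ν ω‖ ^ 2 ∂Pr + ∫ ω, ‖ν' ω‖ ^ 2 ∂Pr) ≤
      3 * τ ^ 2 * (σ ^ 2 + σ ^ 2) := by
    gcongr
    exacts [hz.integral_norm_noise_sq_le hO hξ hind, hh.integral_norm_noise_sq_le hO hξ hind]
  refine (integral_mono_of_nonneg (ae_of_all _ fun _ => by positivity)
    ((hsq_int.sub hinner_int).add hnoise_int) (ae_of_all _ hstep)).trans ?_
  rw [integral_add' (hsq_int.sub hinner_int) hnoise_int, integral_sub' hsq_int hinner_int]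
  simp only [Pi.add_apply]
  rw [integral_const_mul, integral_const_mul, integral_const_mul, integral_add hν_int hν'_int,
    hh.integral_inner_noise_eq_zero hhz hO hξ hind]
  linarith

/-- The point `z_{t+1/2}` computed by a step of stochastic forward-backward-forward. -/
noncomputable def fbfHalfStep {E S : Type*} [AddCommGroup E] [Module ℝ E] (A : E → Set E)
    (Bt : E → S → E) (τ : ℝ) (seeds : ℕ → S) (z : OracleState E) : E :=
  operatorResolvent (scaleOperator τ A) (z.point - τ • Bt z.point (seeds z.evals))

theorem isAdaptedL2_fbfHalfStep (hA : IsMaximallyMonotone A) (hB : LipschitzWith LB B)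
    (hO : IsStochasticOracle P B Bt σ) (hξ : ∀ n, MeasurePreserving (ξ n) Pr P)
    (hind : iIndepFun ξ Pr) (hτ : 0 < τ) {z : Ω → OracleState E} (hn : ∀ ω, (z ω).evals = n)
    {x : Ω → E} (hz : IsAdaptedL2 ξ Pr n fun ω => (z ω).point) (hx : IsAdaptedL2 ξ Pr n x) :
    IsAdaptedL2 ξ Pr (n + 1) fun ω =>
      fbfHalfStep A (fun y s => Bt y s - x ω) τ (fun n => ξ n ω) (z ω) := by
  simp only [fbfHalfStep, hn]
  exact ((hz.mono n.le_succ).sub (((hz.oracle hB hO hξ hind).sub (hx.mono n.le_succ)).const_smul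
    τ)).comp_lipschitzWith (hA.scale hτ).lipschitzWith_operatorResolvent

theorem isAdaptedL2_fbfStep (hA : IsMaximallyMonotone A) (hB : LipschitzWith LB B)
    (hO : IsStochasticOracle P B Bt σ) (hξ : ∀ n, MeasurePreserving (ξ n) Pr P)
    (hind : iIndepFun ξ Pr) (hτ : 0 < τ) {z : Ω → OracleState E} (hn : ∀ ω, (z ω).evals = n)
    {x : Ω → E} (hz : IsAdaptedL2 ξ Pr n fun ω => (z ω).point) (hx : IsAdaptedL2 ξ Pr n x) :
    IsAdaptedL2 ξ Pr (n + 2) fun ω =>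
      (fbfStep A (fun y s => Bt y s - x ω) τ (fun n => ξ n ω) (z ω)).point := by
  have hh := isAdaptedL2_fbfHalfStep hA hB hO hξ hind hτ hn hz hx
  have hb := (hz.oracle hB hO hξ hind).sub (hx.mono n.le_succ)
  have hb' := (hh.oracle hB hO hξ hind).sub (hx.mono (n.le_add_right 2))
  have hstep := ((hh.add (hb.const_smul τ)).mono (n + 1).le_succ).sub (hb'.const_smul τ)
  simpa only [fbfStep, fbfHalfStep, hn] using hstep

theorem stochasticFBF_evals {E S : Type*} [AddCommGroup E] [Module ℝ E] (A : E → Set E)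
    (BtIn : E → S → E) (LB μ : ℝ) (seeds : ℕ → S) (z₀ : OracleState E) (t : ℕ) :
    (stochasticFBF A BtIn LB μ seeds z₀ t).evals = z₀.evals + 2 * t := by
  induction t with
  | zero => rfl
  | succ t ih => simp only [stochasticFBF, fbfStep, ih, mul_add, mul_one, add_assoc]

theorem stochasticFBF_resolvents {E S : Type*} [AddCommGroup E] [Module ℝ E] (A : E → Set E)
    (BtIn : E → S → E) (LB μ : ℝ) (seeds : ℕ → S) (z₀ : OracleState E) (t : ℕ) :
    (stochasticFBF A BtIn LB μ seeds z₀ t).resolvents = z₀.resolvents + t := by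
  induction t with
  | zero => rfl
  | succ t ih => simp only [stochasticFBF, fbfStep, ih, add_assoc]

theorem isAdaptedL2_stochasticFBF (hA : IsMaximallyMonotone A) (hB : LipschitzWith LB B)
    (hμ : 0 < μ) (hO : IsStochasticOracle P B Bt σ) (hξ : ∀ n, MeasurePreserving (ξ n) Pr P)
    (hind : iIndepFun ξ Pr) {z₀ : Ω → OracleState E} (hn : ∀ ω, (z₀ ω).evals = n)
    (hz₀ : IsAdaptedL2 ξ Pr n fun ω => (z₀ ω).point) (t : ℕ) :
    IsAdaptedL2 ξ Pr (n + 2 * t) fun ω =>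
      (stochasticFBF A Bt LB μ (fun n => ξ n ω) (z₀ ω) t).point := by
  induction t with
  | zero => exact hz₀
  | succ t ih =>
    exact isAdaptedL2_fbfStep (n := n + 2 * t) hA hB hO hξ hind (by positivity)
      (fun ω => by rw [stochasticFBF_evals, hn]) ih (hz₀.mono (n.le_add_right _))

/-- The variable `zs` is the resolvent of `A + (B - Id)` at the starting point, which is the zero
of `A + B - z₀` that the iteration approaches. -/
theorem integral_norm_stochasticFBF_sub_sq_le (hA : IsMaximallyMonotone A)
    (hB : LipschitzWith LB B) (hBμ : IsStronglyMonotone μ B) (hμ : 0 < μ) (hμL : μ ≤ LB)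
    (hO : IsStochasticOracle P B Bt σ) (hξ : ∀ n, MeasurePreserving (ξ n) Pr P)
    (hind : iIndepFun ξ Pr) {z₀ : Ω → OracleState E} (hn : ∀ ω, (z₀ ω).evals = n)
    (hz₀ : IsAdaptedL2 ξ Pr n fun ω => (z₀ ω).point) {zs : Ω → E} (hzs : IsAdaptedL2 ξ Pr n zs)
    (hzs_zero : ∀ ω, (z₀ ω).point - B (zs ω) ∈ A (zs ω)) {N : ℕ} (hN : 0 < N) :
    ∫ ω, ‖(stochasticFBF A Bt LB μ (fun n => ξ n ω) (z₀ ω) N).point - zs ω‖ ^ 2 ∂Pr ≤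
      (3 / 2 * (LB * μ) * ∫ ω, ‖(z₀ ω).point - zs ω‖ ^ 2 ∂Pr + 24 * σ ^ 2) / (μ ^ 2 * N) := by
  refine fbf_recursion_le (d := fun t =>
      ∫ ω, ‖(stochasticFBF A Bt LB μ (fun n => ξ n ω) (z₀ ω) t).point - zs ω‖ ^ 2 ∂Pr)
    hμ hμL (sq_nonneg σ) (integral_nonneg fun _ => by positivity) (fun t => ?_) hN
  set τ : ℝ := 2 / (((t : ℝ) + 1) * μ + 6 * LB) with hτ_def
  have hτ : 0 < τ := by positivity
  have hτL : 3 * τ * LB ≤ 1 := by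
    rw [hτ_def, mul_div_assoc', div_mul_eq_mul_div, div_le_one (by positivity)]
    linarith [mul_pos t.cast_add_one_pos hμ]
  have hevals : ∀ ω, (stochasticFBF A Bt LB μ (fun n => ξ n ω) (z₀ ω) t).evals = n + 2 * t :=
    fun ω => by rw [stochasticFBF_evals, hn]
  have hz := isAdaptedL2_stochasticFBF hA hB hμ hO hξ hind hn hz₀ t
  have hmono := n.le_add_right (2 * t)
  have hh := isAdaptedL2_fbfHalfStep hA hB hO hξ hind hτ hevals hz (hz₀.mono hmono)
  have hstep := integral_norm_fbf_step_sub_sq_le hA.1 hB hBμ hμ.le hμL hO hξ hind hτ.le hτL hz hh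
    (hzs.mono hmono) hzs_zero fun ω => by
      simp only [fbfHalfStep, hevals]
      exact (hA.scale hτ).isResolventValue_operatorResolvent _
  simpa only [stochasticFBF, fbfStep, fbfHalfStep, hevals] using hstep

end StochasticFBF

section InexactHalpern

variable {Ω E : Type*} [MeasurableSpace Ω] {Pr : Measure Ω}
  [NormedAddCommGroup E] [InnerProductSpace ℝ E] {R : E → E}

theorem IsFirmlyNonexpansive.halpernPotential_add_one_le (hR : IsFirmlyNonexpansive R)
    {x x' x₀ e : E} {n : ℝ} (hn : 0 < n)
    (hx' : x' = (1 / (n + 1)) • x₀ + (1 - 1 / (n + 1)) • (x - R x + e)) :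
    halpernPotential (n + 1) (R x') (x' - x₀) ≤ halpernPotential n (R x) (x - x₀)
      + 5 * (n * (n + 1)) * ‖e‖ ^ 2 + n / (n + 1) / 18 * ‖R x‖ ^ 2 := by
  refine _root_.halpernPotential_add_one_le hn ?_ ?_
  · have hweight : 1 / (n + 1) = 1 - n / (n + 1) := by field_simp; ring
    rw [hx', hweight]
    module
  · rw [sub_sub_sub_cancel_right]
    exact hR x' x

theorem IsFirmlyNonexpansive.mul_norm_sq_le_add_halpernPotential (hR : IsFirmlyNonexpansive R)
    {x x₀ xstar : E} (hstar : R xstar = 0) {n : ℝ} (hn : 0 < n) :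
    n * (n + 1) / 4 * ‖R x‖ ^ 2 ≤ ‖x₀ - xstar‖ ^ 2 + halpernPotential n (R x) (x - x₀) :=
  _root_.mul_norm_sq_le_add_halpernPotential hn <| by
    simpa only [hstar, sub_zero, sub_add_sub_cancel] using hR x xstar

theorem integrable_halpernPotential {s a : Ω → E} (hs : MemLp s 2 Pr) (ha : MemLp a 2 Pr) (n : ℝ) :
    Integrable (fun ω => halpernPotential n (s ω) (a ω)) Pr :=
  ((hs.integrable_norm_pow two_ne_zero).const_mul _).add
    ((integrable_inner_of_memLp_two hs ha).const_mul _)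

variable [IsProbabilityMeasure Pr]

/-- Inexact Halpern iteration for the nonexpansive map `Id - R`, with the error `e k` in its `k`-th
evaluation. -/
theorem integral_norm_residual_sq_le_of_halpern (hR : IsFirmlyNonexpansive R) {x₀ xstar : E}
    (hstar : R xstar = 0) {X e : ℕ → Ω → E} (hX : ∀ k, MemLp (X k) 2 Pr)
    (he : ∀ k, MemLp (e k) 2 Pr) (hX_zero : ∀ ω, X 0 ω = x₀)
    (hX_succ : ∀ k ω, X (k + 1) ω = (1 / ((k : ℝ) + 2)) • x₀
      + (1 - 1 / ((k : ℝ) + 2)) • (X k ω - R (X k ω) + e k ω)) {s : ℝ} (hs : 0 ≤ s)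
    (he_sq : ∀ k : ℕ, ∫ ω, ‖e k ω‖ ^ 2 ∂Pr ≤ (3 * ∫ ω, ‖R (X k ω)‖ ^ 2 ∂Pr + 24 * s) /
      (1734 * ((k : ℝ) + 2) ^ 3 * Real.log ((k : ℝ) + 2) ^ 2)) (k : ℕ) :
    ∫ ω, ‖R (X k ω)‖ ^ 2 ∂Pr ≤ 36 * (‖x₀ - xstar‖ ^ 2 + s) / ((k + 1) * (k + 2)) := by
  have hR_mem : ∀ k, MemLp (fun ω => R (X k ω)) 2 Pr := fun k =>
    memLp_comp_of_lipschitzWith hR.lipschitzWith (hX k)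
  have hR_int := fun k => (hR_mem k).integrable_norm_pow two_ne_zero
  let V : ℕ → Ω → ℝ := fun k ω => halpernPotential (k + 1) (R (X k ω)) (X k ω - x₀)
  have hV_int : ∀ k, Integrable (V k) Pr := fun k =>
    integrable_halpernPotential (hR_mem k) ((hX k).sub (memLp_const x₀)) _
  refine halpern_recursion_le (V := fun k => ∫ ω, V k ω ∂Pr)
    (e := fun k => ∫ ω, ‖e k ω‖ ^ 2 ∂Pr) (sq_nonneg _) hs
    (by simp [V, halpernPotential, hX_zero]) (fun k => ?_) (fun k => ?_) he_sq k
  · have hstep : ∀ ω, V (k + 1) ω ≤ V k ω + 5 * (((k : ℝ) + 1) * (k + 2)) * ‖e k ω‖ ^ 2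
        + (k + 1) / (k + 2) / 18 * ‖R (X k ω)‖ ^ 2 := fun ω => by
      have hpot := hR.halpernPotential_add_one_le (n := (k : ℝ) + 1) (by positivity)
        (by convert hX_succ k ω using 4 <;> ring)
      convert hpot using 5 <;> push_cast <;> ring
    have he_int := ((he k).integrable_norm_pow two_ne_zero).const_mul
      (5 * (((k : ℝ) + 1) * (k + 2)))
    have hR_int' := (hR_int k).const_mul (((k : ℝ) + 1) / (k + 2) / 18)
    refine (integral_mono (hV_int (k + 1)) (((hV_int k).add he_int).add hR_int') hstep).trans_eq ?_
    rw [integral_add' ((hV_int k).add he_int) hR_int', integral_add' (hV_int k) he_int,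
      integral_const_mul, integral_const_mul]
  · have hlower : ∀ ω, ((k : ℝ) + 1) * (k + 2) / 4 * ‖R (X k ω)‖ ^ 2 ≤
        ‖x₀ - xstar‖ ^ 2 + V k ω := fun ω => by
      convert hR.mul_norm_sq_le_add_halpernPotential hstar (n := (k : ℝ) + 1) (by positivity)
        using 4
      ring
    have hconst_int : Integrable (fun _ => ‖x₀ - xstar‖ ^ 2) Pr := integrable_const _
    have hmono := integral_mono ((hR_int k).const_mul _) (hconst_int.add (hV_int k)) hlower
    rw [integral_const_mul, integral_add' hconst_int (hV_int k)] at hmono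
    simpa using hmono

end InexactHalpern

section StochasticHalpern

theorem le_mul_innerIterations {η L : ℝ} (hηL : η * L < 1) (k : ℕ) :
    1734 * ((k : ℝ) + 2) ^ 3 * Real.log ((k : ℝ) + 2) ^ 2 ≤
      (1 - η * L) ^ 2 * innerIterations η L k := by
  rw [← div_le_iff₀' (pow_pos (sub_pos.2 hηL) 2)]
  exact Nat.le_ceil _

theorem innerIterations_pos {η L : ℝ} (hηL : η * L < 1) (k : ℕ) : 0 < innerIterations η L k :=
  have := log_add_two_pos k
  have := sub_pos.2 hηL
  Nat.ceil_pos.2 (by positivity)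

/-- The approximation `J̃_k` of the resolvent of `η (F + G)` at the point of `z`, with the oracle
calls made for it. -/
noncomputable def approxResolvent {E S : Type*} [AddCommGroup E] [Module ℝ E] (G : E → Set E)
    (Ft : E → S → E) (η L : ℝ) (k : ℕ) (seeds : ℕ → S) (z : OracleState E) : OracleState E :=
  stochasticFBF (scaleOperator η G) (fun z s => z + η • Ft z s) (1 + η * L) (1 - η * L) seeds z
    (innerIterations η L k)

theorem stochasticHalpern_evals {E S : Type*} [AddCommGroup E] [Module ℝ E] (G : E → Set E)
    (Ft : E → S → E) (η L ρ : ℝ) (x₀ : E) (seeds : ℕ → S) (k : ℕ) :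
    (stochasticHalpern G Ft η L ρ x₀ seeds k).evals =
      2 * ∑ j ∈ Finset.range k, innerIterations η L j := by
  induction k with
  | zero => rfl
  | succ k ih =>
    simp only [stochasticHalpern, stochasticFBF_evals, ih, Finset.sum_range_succ, mul_add]

theorem stochasticHalpern_resolvents {E S : Type*} [AddCommGroup E] [Module ℝ E] (G : E → Set E)
    (Ft : E → S → E) (η L ρ : ℝ) (x₀ : E) (seeds : ℕ → S) (k : ℕ) :
    (stochasticHalpern G Ft η L ρ x₀ seeds k).resolvents =
      ∑ j ∈ Finset.range k, innerIterations η L j := by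
  induction k with
  | zero => rfl
  | succ k ih =>
    simp only [stochasticHalpern, stochasticFBF_resolvents, ih, Finset.sum_range_succ]

variable {Ω S E : Type*} [MeasurableSpace Ω] [MeasurableSpace S] {Pr : Measure Ω}
  [IsProbabilityMeasure Pr] {P : Measure S} [NormedAddCommGroup E] [InnerProductSpace ℝ E]
  {ξ : ℕ → Ω → S} {F : E → E} {G : E → Set E} {Ft : E → S → E} {L : ℝ≥0} {η ρ σ : ℝ}

theorem lipschitzWith_id_add_smul (hF : LipschitzWith L F) (η : ℝ) :
    LipschitzWith (1 + ‖η‖₊ * L) fun z => z + η • F z :=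
  LipschitzWith.id.add ((lipschitzWith_smul η).comp hF)

variable [CompleteSpace E] [SecondCountableTopology E] [MeasurableSpace E] [BorelSpace E]

theorem isAdaptedL2_approxResolvent (hF : LipschitzWith L F) (hG : IsMaximallyMonotone G)
    (hO : IsStochasticOracle P F Ft σ) (hξ : ∀ n, MeasurePreserving (ξ n) Pr P)
    (hind : iIndepFun ξ Pr) (hη : 0 < η) (hηL : η * L < 1) {n : ℕ} {z : Ω → OracleState E}
    (hn : ∀ ω, (z ω).evals = n) (hz : IsAdaptedL2 ξ Pr n fun ω => (z ω).point) (k : ℕ) :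
    IsAdaptedL2 ξ Pr (n + 2 * innerIterations η L k) fun ω =>
      (approxResolvent G Ft η L k (fun n => ξ n ω) (z ω)).point := by
  have := isProbabilityMeasure_of_measurePreserving (hξ 0)
  have hLB : ((1 + ‖η‖₊ * L : ℝ≥0) : ℝ) = 1 + η * L := by simp [abs_of_pos hη]
  simpa only [approxResolvent, hLB] using isAdaptedL2_stochasticFBF (hG.scale hη)
    (lipschitzWith_id_add_smul hF η) (sub_pos.2 hηL) (hO.id_add_smul η) hξ hind hn hz
    (innerIterations η L k)

theorem integral_norm_approxResolvent_sub_sq_le (hF : LipschitzWith L F)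
    (hG : IsMaximallyMonotone G) (hO : IsStochasticOracle P F Ft σ)
    (hξ : ∀ n, MeasurePreserving (ξ n) Pr P) (hind : iIndepFun ξ Pr) (hη : 0 < η)
    (hηL : η * L < 1) {n : ℕ} {z : Ω → OracleState E} (hn : ∀ ω, (z ω).evals = n)
    (hz : IsAdaptedL2 ξ Pr n fun ω => (z ω).point) (k : ℕ) :
    ∫ ω, ‖(approxResolvent G Ft η L k (fun n => ξ n ω) (z ω)).point -
        operatorResolvent (scaleOperator η (sumOperator F G)) (z ω).point‖ ^ 2 ∂Pr ≤
      (3 * ∫ ω, ‖(z ω).point -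
          operatorResolvent (scaleOperator η (sumOperator F G)) (z ω).point‖ ^ 2 ∂Pr
        + 24 * (η ^ 2 * σ ^ 2)) / (1734 * ((k : ℝ) + 2) ^ 3 * Real.log ((k : ℝ) + 2) ^ 2) := by
  have := isProbabilityMeasure_of_measurePreserving (hξ 0)
  have hLB : ((1 + ‖η‖₊ * L : ℝ≥0) : ℝ) = 1 + η * L := by simp [abs_of_pos hη]
  have hηL0 : 0 ≤ η * L := by positivity
  have hJz := hz.comp_lipschitzWith
    (hG.lipschitzWith_operatorResolvent_sumOperator hF hη hηL)
  have hJz_res := fun ω => isResolventValue_scaleOperator_sumOperator_iff.1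
    (hG.isResolventValue_operatorResolvent_sumOperator hF hη hηL (z ω).point)
  have hfbf := integral_norm_stochasticFBF_sub_sq_le (hG.scale hη)
    (lipschitzWith_id_add_smul hF η) (isStronglyMonotone_id_add_smul hF hη.le) (sub_pos.2 hηL)
    (by rw [hLB]; linarith) (hO.id_add_smul η) hξ hind hn hz hJz
    (fun ω => by simpa only [IsResolventValue, sub_sub, add_comm] using hJz_res ω)
    (innerIterations_pos hηL k)
  rw [hLB] at hfbf
  have hlog := log_add_two_pos k
  refine hfbf.trans (div_le_div₀ (by positivity) ?_ (by positivity)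
    (le_mul_innerIterations hηL k))
  rw [mul_pow]
  gcongr
  nlinarith

theorem isAdaptedL2_stochasticHalpern (hF : LipschitzWith L F) (hG : IsMaximallyMonotone G)
    (hO : IsStochasticOracle P F Ft σ) (hξ : ∀ n, MeasurePreserving (ξ n) Pr P)
    (hind : iIndepFun ξ Pr) (hη : 0 < η) (hηL : η * L < 1) (ρ : ℝ) (x₀ : E) (k : ℕ) :
    IsAdaptedL2 ξ Pr (2 * ∑ j ∈ Finset.range k, innerIterations η L j) fun ω =>
      (stochasticHalpern G Ft η L ρ x₀ (fun n => ξ n ω) k).point := by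
  induction k with
  | zero => exact .const ξ _ x₀
  | succ k ih =>
    rw [Finset.sum_range_succ, mul_add]
    have hJ := isAdaptedL2_approxResolvent hF hG hO hξ hind hη hηL
      (fun ω => stochasticHalpern_evals G Ft η L ρ x₀ _ k) ih k
    exact (IsAdaptedL2.const ξ _ _).add ((((ih.mono (Nat.le_add_right _ _)).const_smul _).add
      (hJ.const_smul _)).const_smul _)

/-- The residual `x_k - J x_k` of stochastic Halpern iteration at the resolvent `J` of
`η (F + G)`. -/
noncomputable def halpernResidual {E S : Type*} [AddCommGroup E] [Module ℝ E] (F : E → E)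
    (G : E → Set E) (Ft : E → S → E) (η L ρ : ℝ) (x₀ : E) (seeds : ℕ → S) (k : ℕ) : E :=
  (stochasticHalpern G Ft η L ρ x₀ seeds k).point -
    operatorResolvent (scaleOperator η (sumOperator F G))
      (stochasticHalpern G Ft η L ρ x₀ seeds k).point

theorem memLp_halpernResidual (hF : LipschitzWith L F) (hG : IsMaximallyMonotone G)
    (hO : IsStochasticOracle P F Ft σ) (hξ : ∀ n, MeasurePreserving (ξ n) Pr P)
    (hind : iIndepFun ξ Pr) (hη : 0 < η) (hηL : η * L < 1) (ρ : ℝ) (x₀ : E) (k : ℕ) :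
    MemLp (fun ω => halpernResidual F G Ft η L ρ x₀ (fun n => ξ n ω) k) 2 Pr :=
  have hx := isAdaptedL2_stochasticHalpern hF hG hO hξ hind hη hηL ρ x₀ k
  hx.memLp.sub (memLp_comp_of_lipschitzWith
    (hG.lipschitzWith_operatorResolvent_sumOperator hF hη hηL) hx.memLp)

/-- The error `α (J̃_k - J x_k)` with which stochastic Halpern iteration evaluates the map
`(1 - α) Id + α J`, for `α = 1 - ρ / η`. -/
noncomputable def halpernError {E S : Type*} [AddCommGroup E] [Module ℝ E] (F : E → E)
    (G : E → Set E) (Ft : E → S → E) (η L ρ : ℝ) (x₀ : E) (seeds : ℕ → S) (k : ℕ) : E :=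
  (1 - ρ / η) •
    ((approxResolvent G Ft η L k seeds (stochasticHalpern G Ft η L ρ x₀ seeds k)).point -
      operatorResolvent (scaleOperator η (sumOperator F G))
        (stochasticHalpern G Ft η L ρ x₀ seeds k).point)

theorem memLp_halpernError (hF : LipschitzWith L F) (hG : IsMaximallyMonotone G)
    (hO : IsStochasticOracle P F Ft σ) (hξ : ∀ n, MeasurePreserving (ξ n) Pr P)
    (hind : iIndepFun ξ Pr) (hη : 0 < η) (hηL : η * L < 1) (ρ : ℝ) (x₀ : E) (k : ℕ) :
    MemLp (fun ω => halpernError F G Ft η L ρ x₀ (fun n => ξ n ω) k) 2 Pr :=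
  have hx := isAdaptedL2_stochasticHalpern hF hG hO hξ hind hη hηL ρ x₀ k
  have hJt := isAdaptedL2_approxResolvent hF hG hO hξ hind hη hηL
    (fun ω => stochasticHalpern_evals G Ft η L ρ x₀ (fun n => ξ n ω) k) hx k
  (hJt.memLp.sub (memLp_comp_of_lipschitzWith
    (hG.lipschitzWith_operatorResolvent_sumOperator hF hη hηL) hx.memLp)).const_smul _

theorem integral_norm_halpernError_sq_le (hF : LipschitzWith L F) (hG : IsMaximallyMonotone G)
    (hO : IsStochasticOracle P F Ft σ) (hξ : ∀ n, MeasurePreserving (ξ n) Pr P)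
    (hind : iIndepFun ξ Pr) (hρ : 0 ≤ ρ) (hηL : η * L < 1) (hρη : ρ < η) (x₀ : E) (k : ℕ) :
    ∫ ω, ‖halpernError F G Ft η L ρ x₀ (fun n => ξ n ω) k‖ ^ 2 ∂Pr ≤
      (3 * ∫ ω, ‖(1 - ρ / η) • halpernResidual F G Ft η L ρ x₀ (fun n => ξ n ω) k‖ ^ 2 ∂Pr
        + 24 * (η ^ 2 * σ ^ 2)) / (1734 * ((k : ℝ) + 2) ^ 3 * Real.log ((k : ℝ) + 2) ^ 2) := by
  have hη : 0 < η := hρ.trans_lt hρη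
  have hα_sq : (1 - ρ / η) ^ 2 ≤ 1 :=
    pow_le_one₀ (sub_nonneg.2 ((div_le_one hη).2 hρη.le)) (sub_le_self 1 (by positivity))
  have happrox := integral_norm_approxResolvent_sub_sq_le hF hG hO hξ hind hη hηL
    (fun ω => stochasticHalpern_evals G Ft η L ρ x₀ (fun n => ξ n ω) k)
    (isAdaptedL2_stochasticHalpern hF hG hO hξ hind hη hηL ρ x₀ k) k
  have hlog := log_add_two_pos k
  simp only [halpernError, halpernResidual, norm_smul, mul_pow, integral_const_mul,
    Real.norm_eq_abs, sq_abs]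
  refine (mul_le_mul_of_nonneg_left happrox (sq_nonneg _)).trans ?_
  rw [← mul_div_assoc]
  gcongr
  nlinarith [mul_le_mul_of_nonneg_right hα_sq (by positivity : 0 ≤ 24 * (η ^ 2 * σ ^ 2))]

theorem stochasticHalpern_succ_point {E S : Type*} [AddCommGroup E] [Module ℝ E] (F : E → E)
    (G : E → Set E) (Ft : E → S → E) (η L ρ : ℝ) (x₀ : E) (seeds : ℕ → S) (k : ℕ) :
    (stochasticHalpern G Ft η L ρ x₀ seeds (k + 1)).point =
      (1 / ((k : ℝ) + 2)) • x₀ + (1 - 1 / ((k : ℝ) + 2)) •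
        ((stochasticHalpern G Ft η L ρ x₀ seeds k).point
          - (1 - ρ / η) • halpernResidual F G Ft η L ρ x₀ seeds k
          + halpernError F G Ft η L ρ x₀ seeds k) := by
  simp only [stochasticHalpern, halpernResidual, halpernError, approxResolvent]
  module

theorem integral_norm_smul_halpernResidual_sq_le {x₀ xstar : E} (hF : LipschitzWith L F)
    (hG : IsMaximallyMonotone G) (hstar : 0 ∈ sumOperator F G xstar) (hρ : 0 ≤ ρ)
    (hFG : IsCohypomonotone ρ (sumOperator F G)) (hO : IsStochasticOracle P F Ft σ)
    (hξ : ∀ n, MeasurePreserving (ξ n) Pr P) (hind : iIndepFun ξ Pr) (hηL : η * L < 1)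
    (hρη : ρ < η) (k : ℕ) :
    ∫ ω, ‖(1 - ρ / η) • halpernResidual F G Ft η L ρ x₀ (fun n => ξ n ω) k‖ ^ 2 ∂Pr ≤
      36 * (‖x₀ - xstar‖ ^ 2 + η ^ 2 * σ ^ 2) / ((k + 1) * (k + 2)) := by
  have hη : 0 < η := hρ.trans_lt hρη
  have hJ := hG.isResolventValue_operatorResolvent_sumOperator hF hη hηL
  have hJ_star : operatorResolvent (scaleOperator η (sumOperator F G)) xstar = xstar :=
    (hG.existsUnique_isResolventValue_sumOperator hF hη hηL xstar).unique (hJ xstar)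
      ⟨0, hstar, by simp⟩
  exact integral_norm_residual_sq_le_of_halpern (xstar := xstar)
    (hFG.isFirmlyNonexpansive_smul_sub hη hρη.le hJ) (by simp [hJ_star])
    (fun k => (isAdaptedL2_stochasticHalpern hF hG hO hξ hind hη hηL ρ x₀ k).memLp)
    (memLp_halpernError hF hG hO hξ hind hη hηL ρ x₀) (fun _ => rfl)
    (fun k ω => stochasticHalpern_succ_point F G Ft η L ρ x₀ (fun n => ξ n ω) k) (by positivity)
    (integral_norm_halpernError_sq_le hF hG hO hξ hind hρ hηL hρη x₀) k

theorem integral_norm_halpernResidual_sq_le {x₀ xstar : E} (hF : LipschitzWith L F)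
    (hG : IsMaximallyMonotone G) (hstar : 0 ∈ sumOperator F G xstar) (hρ : 0 ≤ ρ)
    (hFG : IsCohypomonotone ρ (sumOperator F G)) (hO : IsStochasticOracle P F Ft σ)
    (hξ : ∀ n, MeasurePreserving (ξ n) Pr P) (hind : iIndepFun ξ Pr) (hηL : η * L < 1)
    (hρη : ρ < η) {k : ℕ} (hk : 1 ≤ k) :
    1 / η ^ 2 * ∫ ω, ‖halpernResidual F G Ft η L ρ x₀ (fun n => ξ n ω) k‖ ^ 2 ∂Pr ≤
      36 * (‖x₀ - xstar‖ ^ 2 + η ^ 2 * σ ^ 2) / ((η - ρ) ^ 2 * (k : ℝ) ^ 2) := by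
  have hη : 0 < η := hρ.trans_lt hρη
  have := sub_pos.2 hρη
  have hsmul := integral_norm_smul_halpernResidual_sq_le (x₀ := x₀) hF hG hstar hρ hFG hO hξ hind
    hηL hρη k
  have hα_sq : (1 - ρ / η) ^ 2 = (η - ρ) ^ 2 * (1 / η ^ 2) := by field_simp
  simp only [norm_smul, mul_pow, integral_const_mul, Real.norm_eq_abs, sq_abs, hα_sq] at hsmul
  rw [mul_comm ((η - ρ) ^ 2) ((k : ℝ) ^ 2), ← div_div, le_div_iff₀' (by positivity), ← mul_assoc]
  refine hsmul.trans ?_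
  gcongr
  nlinarith

theorem integral_inv_mul_norm_halpernResidual_le {x₀ xstar : E} (hF : LipschitzWith L F)
    (hG : IsMaximallyMonotone G) (hstar : 0 ∈ sumOperator F G xstar) (hρ : 0 ≤ ρ)
    (hFG : IsCohypomonotone ρ (sumOperator F G)) (hO : IsStochasticOracle P F Ft σ)
    (hξ : ∀ n, MeasurePreserving (ξ n) Pr P) (hind : iIndepFun ξ Pr) (hηL : η * L < 1)
    (hρη : ρ < η) {k : ℕ} (hk : 1 ≤ k) :
    ∫ ω, η⁻¹ * ‖halpernResidual F G Ft η L ρ x₀ (fun n => ξ n ω) k‖ ∂Pr ≤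
      6 * √(‖x₀ - xstar‖ ^ 2 + (η * σ) ^ 2) / ((η - ρ) * k) := by
  have hη : 0 < η := hρ.trans_lt hρη
  have := sub_pos.2 hρη
  have hres := memLp_halpernResidual hF hG hO hξ hind hη hηL ρ x₀ k
  refine (abs_le_of_sq_le_sq' ?_ (by positivity)).2
  calc (∫ ω, η⁻¹ * ‖halpernResidual F G Ft η L ρ x₀ (fun n => ξ n ω) k‖ ∂Pr) ^ 2
      = 1 / η ^ 2 * (∫ ω, ‖halpernResidual F G Ft η L ρ x₀ (fun n => ξ n ω) k‖ ∂Pr) ^ 2 := by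
        rw [integral_const_mul, mul_pow, inv_pow, one_div]
    _ ≤ 1 / η ^ 2 * ∫ ω, ‖halpernResidual F G Ft η L ρ x₀ (fun n => ξ n ω) k‖ ^ 2 ∂Pr := by
        gcongr
        exact sq_integral_le_integral_sq hres.norm
    _ ≤ 36 * (‖x₀ - xstar‖ ^ 2 + η ^ 2 * σ ^ 2) / ((η - ρ) ^ 2 * (k : ℝ) ^ 2) :=
        integral_norm_halpernResidual_sq_le hF hG hstar hρ hFG hO hξ hind hηL hρη hk
    _ = (6 * √(‖x₀ - xstar‖ ^ 2 + (η * σ) ^ 2) / ((η - ρ) * k)) ^ 2 := by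
        rw [div_pow, mul_pow, Real.sq_sqrt (by positivity)]
        ring

end StochasticHalpern

section Complexity

theorem innerIterations_le {η L : ℝ} (hηL₀ : 0 ≤ η * L) (hηL : η * L < 1) (j : ℕ) :
    (innerIterations η L j : ℝ) ≤
      1735 * ((j : ℝ) + 2) ^ 3 * Real.log ((j : ℝ) + 2) ^ 2 / (1 - η * L) ^ 2 := by
  have hμ : 0 < 1 - η * L := sub_pos.2 hηL
  have hμ_sq : (1 - η * L) ^ 2 ≤ 1 := pow_le_one₀ hμ.le (sub_le_self 1 hηL₀)
  have hj : (2 : ℝ) ≤ j + 2 := le_add_of_nonneg_left j.cast_nonneg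
  have hlog : (0.69 : ℝ) ≤ Real.log ((j : ℝ) + 2) :=
    (by linarith [Real.log_two_gt_d9] : (0.69 : ℝ) ≤ Real.log 2).trans
      (Real.log_le_log two_pos hj)
  have hone : 1 ≤ ((j : ℝ) + 2) ^ 3 * Real.log ((j : ℝ) + 2) ^ 2 / (1 - η * L) ^ 2 := by
    rw [le_div_iff₀ (by positivity), one_mul]
    calc (1 - η * L) ^ 2 ≤ 2 ^ 3 * 0.69 ^ 2 := hμ_sq.trans (by norm_num)
      _ ≤ ((j : ℝ) + 2) ^ 3 * Real.log ((j : ℝ) + 2) ^ 2 := by gcongr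
  calc (innerIterations η L j : ℝ)
      ≤ 1734 * ((j : ℝ) + 2) ^ 3 * Real.log ((j : ℝ) + 2) ^ 2 / (1 - η * L) ^ 2 + 1 :=
        (Nat.ceil_lt_add_one (by positivity)).le
    _ ≤ 1734 * ((j : ℝ) + 2) ^ 3 * Real.log ((j : ℝ) + 2) ^ 2 / (1 - η * L) ^ 2
        + ((j : ℝ) + 2) ^ 3 * Real.log ((j : ℝ) + 2) ^ 2 / (1 - η * L) ^ 2 := by gcongr
    _ = _ := by ring

theorem sum_innerIterations_le {η L : ℝ} (hηL₀ : 0 ≤ η * L) (hηL : η * L < 1) (K : ℕ) :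
    ∑ j ∈ Finset.range K, (innerIterations η L j : ℝ) ≤
      1735 * ((K : ℝ) + 1) ^ 4 * Real.log ((K : ℝ) + 1) ^ 2 / (1 - η * L) ^ 2 := by
  have hterm : ∀ j ∈ Finset.range K, (innerIterations η L j : ℝ) ≤
      1735 * ((K : ℝ) + 1) ^ 3 * Real.log ((K : ℝ) + 1) ^ 2 / (1 - η * L) ^ 2 := fun j hj => by
    have hjK : (j : ℝ) + 2 ≤ K + 1 := by exact_mod_cast Nat.succ_le_succ (Finset.mem_range.1 hj)
    have hlog := (log_add_two_pos j).le
    exact (innerIterations_le hηL₀ hηL j).trans (by gcongr)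
  calc ∑ j ∈ Finset.range K, (innerIterations η L j : ℝ)
      ≤ K * (1735 * ((K : ℝ) + 1) ^ 3 * Real.log ((K : ℝ) + 1) ^ 2 / (1 - η * L) ^ 2) := by
        simpa using Finset.sum_le_card_nsmul _ _ _ hterm
    _ ≤ (K + 1) * (1735 * ((K : ℝ) + 1) ^ 3 * Real.log ((K : ℝ) + 1) ^ 2 / (1 - η * L) ^ 2) := by
        gcongr; exact le_add_of_nonneg_right zero_le_one
    _ = _ := by ring

theorem exists_nat_six_mul_le {q Q : ℝ} (hq : 0 ≤ q) (hqQ : q ^ 4 ≤ 2 * Q) :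
    ∃ K : ℕ, 1 ≤ K ∧ 6 * q ≤ K ∧ ((K : ℝ) + 1) ^ 4 ≤ 20736 * (1 + Q) := by
  refine ⟨max 1 ⌈6 * q⌉₊, le_max_left _ _, (Nat.le_ceil _).trans ?_, ?_⟩
  · exact_mod_cast le_max_right _ _
  have hK : ((max 1 ⌈6 * q⌉₊ : ℕ) : ℝ) ≤ 6 * q + 1 := by
    rw [Nat.cast_max, Nat.cast_one]
    exact max_le (by linarith) (Nat.ceil_lt_add_one (by positivity)).le
  calc (((max 1 ⌈6 * q⌉₊ : ℕ) : ℝ) + 1) ^ 4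
      ≤ (6 * q + 2) ^ 4 := pow_le_pow_left₀ (by positivity) (by linarith) 4
    _ ≤ 2 ^ 3 * ((6 * q) ^ 4 + 2 ^ 4) := add_pow_le (by positivity) zero_le_two 4
    _ ≤ 20736 * (1 + Q) := by linarith

theorem log_add_one_le_four_mul_log {K Q : ℝ} (hK : 0 ≤ K) (hQ : 0 ≤ Q)
    (hKQ : (K + 1) ^ 4 ≤ 20736 * (1 + Q)) : Real.log (K + 1) ≤ 4 * Real.log (2 + Q) := by
  have hpow : (K + 1) ^ 4 ≤ (2 + Q) ^ 16 :=
    calc (K + 1) ^ 4 ≤ 20736 * (1 + Q) := hKQ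
      _ ≤ 2 ^ 15 * (2 + Q) := by linarith
      _ ≤ (2 + Q) ^ 15 * (2 + Q) := by gcongr; linarith
      _ = (2 + Q) ^ 16 := by ring
  have hlog := Real.log_le_log (by positivity) hpow
  rw [Real.log_pow, Real.log_pow] at hlog
  push_cast at hlog
  linarith

theorem max_evals_resolvents_stochasticHalpern_le {E S : Type*} [AddCommGroup E] [Module ℝ E]
    (G : E → Set E) (Ft : E → S → E) {η L : ℝ} (hηL₀ : 0 ≤ η * L) (hηL : η * L < 1) (ρ : ℝ)
    (x₀ : E) (seeds : ℕ → S) {K : ℕ} {Q : ℝ} (hQ : 0 ≤ Q)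
    (hKQ : ((K : ℝ) + 1) ^ 4 ≤ 20736 * (1 + Q)) :
    (max (stochasticHalpern G Ft η L ρ x₀ seeds K).evals
        (stochasticHalpern G Ft η L ρ x₀ seeds K).resolvents : ℝ) ≤
      10 ^ 10 * ((1 + Q) / (1 - η * L) ^ 2) * Real.log (2 + Q) ^ 2 := by
  have hlog_nonneg : 0 ≤ Real.log ((K : ℝ) + 1) :=
    Real.log_nonneg (le_add_of_nonneg_left K.cast_nonneg)
  have hlog := log_add_one_le_four_mul_log K.cast_nonneg hQ hKQ
  rw [stochasticHalpern_evals, stochasticHalpern_resolvents]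
  push_cast
  calc max (2 * ∑ j ∈ Finset.range K, (innerIterations η L j : ℝ))
        (∑ j ∈ Finset.range K, (innerIterations η L j : ℝ))
      = 2 * ∑ j ∈ Finset.range K, (innerIterations η L j : ℝ) :=
        max_eq_left (le_mul_of_one_le_left (by positivity) one_le_two)
    _ ≤ 2 * (1735 * ((K : ℝ) + 1) ^ 4 * Real.log ((K : ℝ) + 1) ^ 2 / (1 - η * L) ^ 2) := by
        gcongr
        exact sum_innerIterations_le hηL₀ hηL K
    _ ≤ 2 * (1735 * (20736 * (1 + Q)) * (4 * Real.log (2 + Q)) ^ 2 / (1 - η * L) ^ 2) := by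
        gcongr
    _ = 2 * 1735 * 20736 * 4 ^ 2 * ((1 + Q) / (1 - η * L) ^ 2) * Real.log (2 + Q) ^ 2 := by ring
    _ ≤ 10 ^ 10 * ((1 + Q) / (1 - η * L) ^ 2) * Real.log (2 + Q) ^ 2 := by gcongr; norm_num

theorem sqrt_div_pow_four_le (a b c : ℝ) :
    (√(a ^ 2 + b ^ 2) / c) ^ 4 ≤ 2 * ((a ^ 4 + b ^ 4) / c ^ 4) := by
  have hsqrt : √(a ^ 2 + b ^ 2) ^ 4 = (a ^ 2 + b ^ 2) ^ 2 := by
    rw [← Real.sq_sqrt (by positivity : 0 ≤ a ^ 2 + b ^ 2)]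
    simp only [Real.sqrt_sq (Real.sqrt_nonneg _)]
    ring
  rw [div_pow, hsqrt, ← mul_div_assoc]
  gcongr
  linarith [sq_nonneg (a ^ 2 - b ^ 2)]

end Complexity

theorem theoremC2_general {E Ω S : Type*} [NormedAddCommGroup E] [InnerProductSpace ℝ E]
    [CompleteSpace E] [SecondCountableTopology E] [MeasurableSpace E] [BorelSpace E]
    [MeasurableSpace Ω] {Pr : Measure Ω} [IsProbabilityMeasure Pr] [MeasurableSpace S]
    {P : Measure S} {F : E → E} {G : E → Set E} {Ft : E → S → E} {ξ : ℕ → Ω → S} {L : ℝ≥0}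
    {ρ η σ : ℝ} {x₀ xstar : E} (hF : LipschitzWith L F) (hG : IsMaximallyMonotone G)
    (hstar : 0 ∈ sumOperator F G xstar) (hρ : 0 ≤ ρ) (hFG : IsCohypomonotone ρ (sumOperator F G))
    (hO : IsStochasticOracle P F Ft σ) (hξ : ∀ n, MeasurePreserving (ξ n) Pr P)
    (hind : iIndepFun ξ Pr) (hηL : η * L < 1) (hρη : ρ < η) :
    (∀ x, ∃! y, IsResolventValue (scaleOperator η (sumOperator F G)) x y) ∧
    (∀ c : ℝ, 0 < c → ∀ x, ∃! y, IsResolventValue (scaleOperator c (scaleOperator η G)) x y) ∧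
    (∀ k : ℕ, 1 ≤ k →
      Integrable (fun ω =>
        ‖(stochasticHalpern G Ft η L ρ x₀ (fun n => ξ n ω) k).point -
          operatorResolvent (scaleOperator η (sumOperator F G))
            (stochasticHalpern G Ft η L ρ x₀ (fun n => ξ n ω) k).point‖ ^ 2) Pr ∧
      1 / η ^ 2 * ∫ ω,
        ‖(stochasticHalpern G Ft η L ρ x₀ (fun n => ξ n ω) k).point -
          operatorResolvent (scaleOperator η (sumOperator F G))
            (stochasticHalpern G Ft η L ρ x₀ (fun n => ξ n ω) k).point‖ ^ 2 ∂Pr ≤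
        36 * (‖x₀ - xstar‖ ^ 2 + η ^ 2 * σ ^ 2) / ((η - ρ) ^ 2 * (k : ℝ) ^ 2)) ∧
    (∀ (k : ℕ) (seeds : ℕ → S),
      (stochasticHalpern G Ft η L ρ x₀ seeds (k + 1)).evals ≤
        (stochasticHalpern G Ft η L ρ x₀ seeds k).evals +
          2 * ⌈1734 * ((k : ℝ) + 2) ^ 3 * Real.log ((k : ℝ) + 2) ^ 2 / (1 - η * L) ^ 2⌉₊ ∧
      (stochasticHalpern G Ft η L ρ x₀ seeds (k + 1)).resolvents ≤
        (stochasticHalpern G Ft η L ρ x₀ seeds k).resolvents +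
          ⌈1734 * ((k : ℝ) + 2) ^ 3 * Real.log ((k : ℝ) + 2) ^ 2 / (1 - η * L) ^ 2⌉₊) ∧
    (∀ ε : ℝ, 0 < ε → ∃ K : ℕ, 1 ≤ K ∧
      Integrable (fun ω =>
        ‖(stochasticHalpern G Ft η L ρ x₀ (fun n => ξ n ω) K).point -
          operatorResolvent (scaleOperator η (sumOperator F G))
            (stochasticHalpern G Ft η L ρ x₀ (fun n => ξ n ω) K).point‖) Pr ∧
      ∫ ω, η⁻¹ *
        ‖(stochasticHalpern G Ft η L ρ x₀ (fun n => ξ n ω) K).point -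
          operatorResolvent (scaleOperator η (sumOperator F G))
            (stochasticHalpern G Ft η L ρ x₀ (fun n => ξ n ω) K).point‖ ∂Pr ≤ ε ∧
      ∀ seeds : ℕ → S,
        (max (stochasticHalpern G Ft η L ρ x₀ seeds K).evals
            (stochasticHalpern G Ft η L ρ x₀ seeds K).resolvents : ℝ) ≤
          10 ^ 10 * ((1 + (‖x₀ - xstar‖ ^ 4 + η ^ 4 * σ ^ 4) / ((η - ρ) ^ 4 * ε ^ 4)) /
                (1 - η * L) ^ 2) *
            Real.log
              (2 + (‖x₀ - xstar‖ ^ 4 + η ^ 4 * σ ^ 4) / ((η - ρ) ^ 4 * ε ^ 4)) ^ 2) := by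
  have hη : 0 < η := hρ.trans_lt hρη
  have hηL₀ : 0 ≤ η * L := by positivity
  have hres_mem := memLp_halpernResidual hF hG hO hξ hind hη hηL ρ x₀
  refine ⟨hG.existsUnique_isResolventValue_sumOperator hF hη hηL, ?_, ?_, ?_, fun ε hε => ?_⟩
  · exact fun c hc => ((hG.scale hη).scale hc).existsUnique_isResolventValue
  · exact fun k hk => ⟨(hres_mem k).integrable_norm_pow two_ne_zero,
      integral_norm_halpernResidual_sq_le hF hG hstar hρ hFG hO hξ hind hηL hρη hk⟩
  · exact fun k seeds => ⟨(stochasticFBF_evals ..).le, (stochasticFBF_resolvents ..).le⟩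
  have := sub_pos.2 hρη
  have hqQ := sqrt_div_pow_four_le ‖x₀ - xstar‖ (η * σ) ((η - ρ) * ε)
  rw [mul_pow η σ 4, mul_pow (η - ρ) ε 4] at hqQ
  obtain ⟨K, hK, hqK, hKQ⟩ := exists_nat_six_mul_le (by positivity) hqQ
  refine ⟨K, hK, (hres_mem K).norm.integrable one_le_two, ?_, fun seeds =>
    max_evals_resolvents_stochasticHalpern_le G Ft hηL₀ hηL ρ x₀ seeds (by positivity) hKQ⟩
  refine (integral_inv_mul_norm_halpernResidual_le hF hG hstar hρ hFG hO hξ hind hηL hρη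
    hK).trans ?_
  rw [← mul_div_assoc, div_le_iff₀ (by positivity)] at hqK
  rw [div_le_iff₀ (by positivity)]
  linarith

theorem theoremC2 :
    ∃ C : ℝ, 0 < C ∧
      ∀ (d : ℕ) (Ω : Type*) [MeasurableSpace Ω] (Pr : Measure Ω) [IsProbabilityMeasure Pr]
        (S : Type*) [MeasurableSpace S] (P : Measure S)
        (F : EuclideanSpace ℝ (Fin d) → EuclideanSpace ℝ (Fin d))
        (G : EuclideanSpace ℝ (Fin d) → Set (EuclideanSpace ℝ (Fin d)))
        (Ft : EuclideanSpace ℝ (Fin d) → S → EuclideanSpace ℝ (Fin d))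
        (ξ : ℕ → Ω → S) (L : ℝ≥0) (ρ η σ : ℝ) (x₀ xstar : EuclideanSpace ℝ (Fin d)),
        LipschitzWith L F →
        IsMaximallyMonotone G →
        0 ∈ sumOperator F G xstar →
        0 < ρ →
        IsMaximallyCohypomonotone ρ (sumOperator F G) →
        0 ≤ σ →
        IsStochasticOracle P F Ft σ →
        (∀ n, Measurable (ξ n)) →
        (∀ n, Pr.map (ξ n) = P) →
        iIndepFun ξ Pr →
        η * L < 1 →
        ρ < η →
        -- all resolvents that occur are defined everywhere and single-valued
        (∀ x, ∃! y, IsResolventValue (scaleOperator η (sumOperator F G)) x y) ∧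
        (∀ c : ℝ, 0 < c → ∀ x, ∃! y, IsResolventValue (scaleOperator c (scaleOperator η G)) x y) ∧
        -- rate of the last iterate
        (∀ k : ℕ, 1 ≤ k →
          Integrable (fun ω =>
            ‖(stochasticHalpern G Ft η L ρ x₀ (fun n => ξ n ω) k).point -
              operatorResolvent (scaleOperator η (sumOperator F G))
                (stochasticHalpern G Ft η L ρ x₀ (fun n => ξ n ω) k).point‖ ^ 2) Pr ∧
          1 / η ^ 2 * ∫ ω,
            ‖(stochasticHalpern G Ft η L ρ x₀ (fun n => ξ n ω) k).point -
              operatorResolvent (scaleOperator η (sumOperator F G))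
                (stochasticHalpern G Ft η L ρ x₀ (fun n => ξ n ω) k).point‖ ^ 2 ∂Pr ≤
            36 * (‖x₀ - xstar‖ ^ 2 + η ^ 2 * σ ^ 2) / ((η - ρ) ^ 2 * (k : ℝ) ^ 2)) ∧
        -- oracle calls made at outer iteration `k`
        (∀ (k : ℕ) (seeds : ℕ → S),
          (stochasticHalpern G Ft η L ρ x₀ seeds (k + 1)).evals ≤
            (stochasticHalpern G Ft η L ρ x₀ seeds k).evals +
              2 * ⌈1734 * ((k : ℝ) + 2) ^ 3 * Real.log ((k : ℝ) + 2) ^ 2 / (1 - η * L) ^ 2⌉₊ ∧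
          (stochasticHalpern G Ft η L ρ x₀ seeds (k + 1)).resolvents ≤
            (stochasticHalpern G Ft η L ρ x₀ seeds k).resolvents +
              ⌈1734 * ((k : ℝ) + 2) ^ 3 * Real.log ((k : ℝ) + 2) ^ 2 / (1 - η * L) ^ 2⌉₊) ∧
        -- total oracle complexity
        (∀ ε : ℝ, 0 < ε → ∃ K : ℕ, 1 ≤ K ∧
          Integrable (fun ω =>
            ‖(stochasticHalpern G Ft η L ρ x₀ (fun n => ξ n ω) K).point -
              operatorResolvent (scaleOperator η (sumOperator F G))
                (stochasticHalpern G Ft η L ρ x₀ (fun n => ξ n ω) K).point‖) Pr ∧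
          ∫ ω, η⁻¹ *
            ‖(stochasticHalpern G Ft η L ρ x₀ (fun n => ξ n ω) K).point -
              operatorResolvent (scaleOperator η (sumOperator F G))
                (stochasticHalpern G Ft η L ρ x₀ (fun n => ξ n ω) K).point‖ ∂Pr ≤ ε ∧
          ∀ seeds : ℕ → S,
            (max (stochasticHalpern G Ft η L ρ x₀ seeds K).evals
                (stochasticHalpern G Ft η L ρ x₀ seeds K).resolvents : ℝ) ≤
              C * ((1 + (‖x₀ - xstar‖ ^ 4 + η ^ 4 * σ ^ 4) / ((η - ρ) ^ 4 * ε ^ 4)) /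
                    (1 - η * L) ^ 2) *
                Real.log
                  (2 + (‖x₀ - xstar‖ ^ 4 + η ^ 4 * σ ^ 4) / ((η - ρ) ^ 4 * ε ^ 4)) ^ 2) :=
  ⟨10 ^ 10, by positivity, fun _ _ _ _ _ _ _ _ _ _ _ _ _ _ _ _ _ _ hF hG hstar hρ hFG _ hO hξ hP
    hind hηL hρη =>
      theoremC2_general hF hG hstar hρ.le hFG.1 hO (fun n => ⟨hξ n, hP n⟩) hind hηL hρη⟩
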